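/- All rings are commutative, and "local ring" means noetherian local ring. A homomorphism of rings $R\to R'$ is of *finite flat dimension* if $R'$, viewed as an $R$-module, has a finite resolution $0\to F_n\to\cdots\to F_0\to R'\to 0$ by flat $R$-modules. A *deformation* $R'\twoheadleftarrow Q$ is a surjective homomorphism from a local ring $Q$ onto the local ring $R'$ whose kernel is generated by a (possibly empty) $Q$-regular sequence. A noetherian ring $R$ has the *Auslander–Reiten property* if every finitely generated $R$-module $M$ satisfies $$\operatorname{proj\,dim}_R M=\sup\{\,i\in\mathbb{Z} \mid \operatorname{Ext}^i_R(M,R\oplus M)\neq 0\,\},$$ where both sides are $-\infty$ for $M=0$, and $\operatorname{Ext}^i=0$ for $i<0$. **Theorem.** Let $R$, $R'$ and $Q$ be local rings. Assume that there exist a local homomorphism $R\to R'$ of finite flat dimension and a deformation $R'\twoheadleftarrow Q$. If $Q$ has the Auslander–Reiten property, then so does $R$. -/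

import Mathlib

open CategoryTheory

universe u v w

/-- An `R`-module `M` has flat dimension at most `n`: there is an exact sequence
`0 → F n → ⋯ → F 1 → F 0 → M → 0` of `R`-modules with every `F i` flat. It is written as a flat
resolution indexed by `ℕ` whose terms vanish above degree `n`. (Allowing flat modules in the
universe `max u v` is no restriction: free resolutions of `M` and their syzygies live there.) -/
def HasFlatDimensionLE (R : Type u) [CommRing R] (M : Type v) [AddCommGroup M] [Module R M]
    (n : ℕ) : Prop :=
  ∃ (F : ℕ → ModuleCat.{max u v} R) (d : ∀ i, F (i + 1) →ₗ[R] F i) (ε : F 0 →ₗ[R] M),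
    (∀ i, Module.Flat R (F i)) ∧
    (∀ i, n < i → Subsingleton (F i)) ∧
    Function.Surjective ε ∧
    Function.Exact (d 0) ε ∧
    ∀ i, Function.Exact (d (i + 1)) (d i)

/-- An `R`-module has finite flat dimension. -/
def HasFiniteFlatDimension (R : Type u) [CommRing R] (M : Type v) [AddCommGroup M]
    [Module R M] : Prop :=
  ∃ n : ℕ, HasFlatDimensionLE R M n

/-- A ring homomorphism `π : Q → R` between (noetherian) local rings is a deformation of `R`
to `Q`: it is surjective and its kernel is generated by a (possibly empty) `Q`-regular sequence. -/
def IsDeformation {Q : Type u} {R : Type v} [CommRing Q] [CommRing R] (π : Q →+* R) : Prop :=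
  Function.Surjective π ∧
    ∃ f : List Q, RingTheory.Sequence.IsRegular Q f ∧ RingHom.ker π = Ideal.ofList f

/-- The Auslander–Reiten property of a commutative (noetherian) ring `R`: every finitely generated
`R`-module `M` satisfies `proj dim M = sup {i | Ext^i_R(M, R ⊕ M) ≠ 0}`. The equality holds in
`WithBot ℕ∞`, so the supremum of the empty set and the projective dimension of the zero module
are both `⊥`, that is, `-∞`. (Finitely generated modules in the universe of `R` are enough: each
finitely generated module is isomorphic to a quotient of some `R ^ n`.) -/
def HasAuslanderReitenProperty (R : Type u) [CommRing R] : Prop :=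
  ∀ (M : Type u) [AddCommGroup M] [Module R M] [Module.Finite R M],
    projectiveDimension (ModuleCat.of R M) =
      ⨆ (i : ℕ) (_ : Nontrivial (Abelian.Ext (ModuleCat.of R M) (ModuleCat.of R (R × M)) i)),
        (i : WithBot ℕ∞)

/-! For a finitely generated M over a noetherian ring, the supremum never exceeds the projective
dimension, and the two agree when the latter is finite. So the property says: if Ext^i(M, R ⊕ M) = 0
for i ≫ 0, then M has finite projective dimension. `MatrixAR` is this assertion for a resolution by
finite free modules with differentials d_i, finite projective dimension meaning that some d_s
splits. Write M_j = coker d_j; dimension shifting gives Ext^i(M, M_j) = 0 for i large relative to j.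

Deformation (`MatrixAR.of_surjective`). By induction the kernel is generated by one nonzerodivisor
f. Lifting d to matrices e over Q gives e_i e_{i+1} = f t_i, and e, t and f assemble into a free
resolution of M over Q (the cone) that inherits the Ext vanishing; by hypothesis it splits at some
s. Then t acts injectively on Ext^i_R(M, M_j) for every i > s, with a bound independent of j. Powers
of t reach degrees where the Ext vanishes, so Ext^i_R(M, M_j) = 0 for all i > s and all j. Taking i
= s + 1 = j, the projection onto M_{s+1} is a coboundary, which splits d_s (`SplitsAt.of_coneDiff`).

Finite flat dimension (`MatrixAR.of_isLocalHom`). The needed exactness holds with flat coefficients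
and passes along a finite flat resolution of R', at the cost of finitely many initial degrees
(`HasFlatDimensionLE.exactCoefficients`). Hence a truncation of d, tensored with R', satisfies the
hypotheses of `MatrixAR` over R' and splits there; the splitting descends because R → R' is local.
-/

open Matrix in
/-- The matrices `d i` are the differentials of a free resolution of the cokernel of `d 0`. -/
def IsMatrixResolution {R : Type u} [CommRing R] {b : ℕ → Type} [∀ i, Fintype (b i)]
    (d : ∀ i, Matrix (b i) (b (i + 1)) R) : Prop :=
  (∀ i, d i * d (i + 1) = 0) ∧
    ∀ i (x : b (i + 1) → R), d i *ᵥ x = 0 → ∃ y, x = d (i + 1) *ᵥ y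

open Matrix in
/-- Vanishing of `Ext^(i+1)(M, R)`, where `M` is the module resolved by `d`. -/
def ExtRingVanish {R : Type u} [CommRing R] {b : ℕ → Type} [∀ i, Fintype (b i)]
    (d : ∀ i, Matrix (b i) (b (i + 1)) R) (i : ℕ) : Prop :=
  ∀ x : b (i + 1) → R, x ᵥ* d (i + 1) = 0 → ∃ y, x = y ᵥ* d i

/-- Vanishing of `Ext^(i+1)(M, coker (d j))`, where `M` is the module resolved by `d`. -/
def ExtSyzygyVanish {R : Type u} [CommRing R] {b : ℕ → Type} [∀ i, Fintype (b i)]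
    (d : ∀ i, Matrix (b i) (b (i + 1)) R) (j i : ℕ) : Prop :=
  ∀ (G : Matrix (b j) (b (i + 1)) R) (Y : Matrix (b (j + 1)) (b (i + 2)) R),
    G * d (i + 1) = d j * Y →
      ∃ (H : Matrix (b j) (b i) R) (Z : Matrix (b (j + 1)) (b (i + 1)) R), G = H * d i + d j * Z

/-- The image of `d i` is a direct summand. -/
def SplitsAt {R : Type u} [CommRing R] {b : ℕ → Type} [∀ i, Fintype (b i)]
    (d : ∀ i, Matrix (b i) (b (i + 1)) R) (i : ℕ) : Prop :=
  ∃ h : Matrix (b (i + 1)) (b i) R, d i * h * d i = d i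

/-- The Auslander–Reiten property in terms of matrices. -/
def MatrixAR (R : Type u) [CommRing R] : Prop :=
  ∀ (b : ℕ → Type) [∀ i, Fintype (b i)] [∀ i, DecidableEq (b i)]
    (d : ∀ i, Matrix (b i) (b (i + 1)) R), IsMatrixResolution d →
    ∀ n, (∀ i, n ≤ i → ExtRingVanish d i) → (∀ i, n ≤ i → ExtSyzygyVanish d 0 i) →
      ∃ s, SplitsAt d s

/-! ### Dimension shifting and split differentials. -/

section Basic

variable {R : Type u} [CommRing R] {b : ℕ → Type} [∀ i, Fintype (b i)]
  {d : ∀ i, Matrix (b i) (b (i + 1)) R}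

theorem IsMatrixResolution.exact (hd : IsMatrixResolution d) {p : Type} {i : ℕ}
    (G : Matrix (b (i + 1)) p R) (hG : d i * G = 0) :
    ∃ Y : Matrix (b (i + 2)) p R, G = d (i + 1) * Y := by
  have h (k : p) : ∃ y, G.col k = (d (i + 1)).mulVec y :=
    hd.2 i _ (funext fun a => congrFun (congrFun hG a) k)
  choose y hy using h
  exact ⟨Matrix.of fun a k => y k a, Matrix.ext fun a k => congrFun (hy k) a⟩

theorem ExtRingVanish.exact {i : ℕ} (hd : ExtRingVanish d i) {p : Type}
    (G : Matrix p (b (i + 1)) R) (hG : G * d (i + 1) = 0) :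
    ∃ Y : Matrix p (b i) R, G = Y * d i := by
  have h (k : p) : ∃ y, G.row k = (d i).vecMul y :=
    hd _ (funext fun a => congrFun (congrFun hG k) a)
  choose y hy using h
  exact ⟨Matrix.of y, Matrix.ext fun k a => congrFun (hy k) a⟩

/-- This is the connecting map for 0 → coker (d (j+1)) → F_j → coker (d j) → 0, with F_j free; `hR`
kills the Ext into F_j. -/
theorem ExtSyzygyVanish.succ (hd : IsMatrixResolution d) {j i : ℕ} (h : ExtSyzygyVanish d j i)
    (hR : ExtRingVanish d (i + 1)) : ExtSyzygyVanish d (j + 1) (i + 1) := by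
  intro G Y hG
  obtain ⟨H', hH'⟩ := hR.exact (d j * G) (by
    rw [Matrix.mul_assoc, hG, ← Matrix.mul_assoc, hd.1, Matrix.zero_mul])
  obtain ⟨H, Z, hH⟩ := h H' G hH'.symm
  obtain ⟨W, hW⟩ := hd.exact (G - Z * d (i + 1)) (by
    rw [Matrix.mul_sub, hH', hH, Matrix.add_mul, Matrix.mul_assoc H, hd.1, Matrix.mul_zero, zero_add,
      Matrix.mul_assoc, sub_self])
  exact ⟨Z, W, by rw [← hW]; abel⟩

theorem ExtSyzygyVanish.add (hd : IsMatrixResolution d) {n : ℕ}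
    (hR : ∀ i, n ≤ i → ExtRingVanish d i) (hM : ∀ i, n ≤ i → ExtSyzygyVanish d 0 i) (j : ℕ) :
    ∀ i, n + j ≤ i → ExtSyzygyVanish d j i := by
  induction j with
  | zero => exact hM
  | succ j ih =>
    intro i hi
    obtain ⟨i, rfl⟩ : ∃ k, i = k + 1 := ⟨i - 1, by omega⟩
    exact (ih i (by omega)).succ hd (hR _ (by omega))

variable [∀ i, DecidableEq (b i)]

/-- A splitting of `d s` gives a contracting homotopy in degree `s + 1`, which in turn splits `d (s
+ 1)`; this is why splitting persists upwards. -/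
theorem SplitsAt.contraction (hd : IsMatrixResolution d) {s : ℕ} (h : SplitsAt d s) :
    ∃ (H : Matrix (b (s + 1)) (b s) R) (K : Matrix (b (s + 2)) (b (s + 1)) R),
      H * d s + d (s + 1) * K = 1 := by
  obtain ⟨H, hH⟩ := h
  obtain ⟨K, hK⟩ := hd.exact (1 - H * d s) (by
    rw [Matrix.mul_sub, Matrix.mul_one, ← Matrix.mul_assoc, hH, sub_self])
  exact ⟨H, K, by rw [← hK]; abel⟩

theorem splitsAt_succ_of_contraction (hd : IsMatrixResolution d) {s : ℕ}
    {H : Matrix (b (s + 1)) (b s) R} {K : Matrix (b (s + 2)) (b (s + 1)) R}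
    (h : H * d s + d (s + 1) * K = 1) : SplitsAt d (s + 1) := by
  refine ⟨K, ?_⟩
  have := congrArg (· * d (s + 1)) h
  simpa [Matrix.add_mul, Matrix.mul_assoc H, hd.1] using this

theorem SplitsAt.mono (hd : IsMatrixResolution d) {s : ℕ} (h : SplitsAt d s) {t : ℕ} (ht : s ≤ t) :
    SplitsAt d t := by
  induction t, ht using Nat.le_induction with
  | base => exact h
  | succ t _ ih =>
    obtain ⟨H, K, e⟩ := ih.contraction hd
    exact splitsAt_succ_of_contraction hd e

end Basic

/-! ### The resolution over Q of a module over Q/(f). -/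

section Cone

/-- The ranks in the free resolution over `Q` built from one over `Q ⧸ (f)`. -/
def coneIndex (b : ℕ → Type) : ℕ → Type
  | 0 => b 0
  | i + 1 => b (i + 1) ⊕ b i

instance coneIndex.fintype (b : ℕ → Type) [∀ i, Fintype (b i)] : ∀ i, Fintype (coneIndex b i)
  | 0 => inferInstanceAs (Fintype (b 0))
  | i + 1 => inferInstanceAs (Fintype (b (i + 1) ⊕ b i))

instance coneIndex.decidableEq (b : ℕ → Type) [∀ i, DecidableEq (b i)] :
    ∀ i, DecidableEq (coneIndex b i)
  | 0 => inferInstanceAs (DecidableEq (b 0))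
  | i + 1 => inferInstanceAs (DecidableEq (b (i + 1) ⊕ b i))

variable {Q : Type w} [CommRing Q] {b : ℕ → Type} [∀ i, Fintype (b i)] [∀ i, DecidableEq (b i)]

/-- The differentials of the free resolution over `Q` built from lifts `e` of the differentials of
a free resolution over `Q ⧸ (f)` with `e i * e (i + 1) = f • t i`. -/
def coneDiff (f : Q) (e : ∀ i, Matrix (b i) (b (i + 1)) Q) (t : ∀ i, Matrix (b i) (b (i + 2)) Q) :
    ∀ i, Matrix (coneIndex b i) (coneIndex b (i + 1)) Q
  | 0 => Matrix.fromCols (e 0) (f • (1 : Matrix (b 0) (b 0) Q))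
  | i + 1 => Matrix.fromBlocks (e (i + 1)) (f • 1) (-t i) (-e i)

variable {R : Type v} [CommRing R] {π : Q →+* R} (hπ : Function.Surjective π)
  {f : Q} (hf : ∀ x, f * x = 0 → x = 0) (hker : RingHom.ker π = Ideal.span {f})
  {d : ∀ i, Matrix (b i) (b (i + 1)) R} (hd : IsMatrixResolution d)
  {e : ∀ i, Matrix (b i) (b (i + 1)) Q} (he : ∀ i, (e i).map π = d i)
  {t : ∀ i, Matrix (b i) (b (i + 2)) Q} (ht : ∀ i, e i * e (i + 1) = f • t i)

include hπ in
theorem Matrix.exists_map_eq {m n : Type} (A : Matrix m n R) :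
    ∃ B : Matrix m n Q, B.map π = A :=
  ⟨A.map (Function.surjInv hπ), Matrix.ext fun _ _ => Function.surjInv_eq hπ _⟩

include hker in
theorem Matrix.exists_eq_smul_of_map_eq {m n : Type} {A B : Matrix m n Q}
    (h : A.map π = B.map π) : ∃ C : Matrix m n Q, A = B + f • C := by
  have (i : m) (j : n) : ∃ c, f * c = A i j - B i j := by
    have : A i j - B i j ∈ RingHom.ker π := by
      rw [RingHom.mem_ker, map_sub, sub_eq_zero]
      exact congrFun (congrFun h i) j
    rw [hker, Ideal.mem_span_singleton] at this
    exact this.imp fun c hc => hc.symm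
  choose c hc using this
  exact ⟨Matrix.of c, Matrix.ext fun i j => by simp [hc]⟩

include hker in
theorem Matrix.map_smul_eq_zero {m n : Type} (A : Matrix m n Q) : (f • A).map π = 0 := by
  have : π f = 0 := by
    rw [← RingHom.mem_ker, hker]; exact Ideal.mem_span_singleton_self f
  ext i j; simp [this]

include hf in
theorem Matrix.smul_left_cancel {m n : Type} {A B : Matrix m n Q} (h : f • A = f • B) : A = B := by
  ext i j
  have := congrFun (congrFun h i) j
  simp only [Matrix.smul_apply, smul_eq_mul] at this
  exact sub_eq_zero.1 (hf _ (by rw [mul_sub, this, sub_self]))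

-- Both sides agree after multiplication by `f`, by associativity of a product of three consecutive
-- `e`. So `t` is a chain map of degree -2, even before reduction modulo `f`.
omit [∀ i, DecidableEq (b i)] in
include hf ht in
theorem cone_comm (i : ℕ) : e i * t (i + 1) = t i * e (i + 2) := by
  apply Matrix.smul_left_cancel hf
  rw [← Matrix.mul_smul, ← ht, ← Matrix.mul_assoc, ht, Matrix.smul_mul]

include hf ht in
theorem coneDiff_mul (i : ℕ) : coneDiff f e t i * coneDiff f e t (i + 1) = 0 := by
  cases i with
  | zero =>
    change Matrix.fromCols (e 0) (f • (1 : Matrix (b 0) (b 0) Q)) *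
      Matrix.fromBlocks (e 1) (f • (1 : Matrix (b 1) (b 1) Q)) (-t 0) (-e 0) = 0
    rw [Matrix.fromCols_mul_fromBlocks]
    simp [ht]
  | succ i =>
    change Matrix.fromBlocks (e (i + 1)) (f • (1 : Matrix (b (i + 1)) (b (i + 1)) Q)) (-t i) (-e i) *
      Matrix.fromBlocks (e (i + 2)) (f • (1 : Matrix (b (i + 2)) (b (i + 2)) Q)) (-t (i + 1))
        (-e (i + 1)) = 0
    rw [Matrix.fromBlocks_multiply, ← Matrix.fromBlocks_zero]
    congr 1 <;> simp [ht, cone_comm hf ht]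

variable (f e t) in
theorem coneDiff_succ_mulVec (i : ℕ) (x₁ : b (i + 2) → Q) (x₂ : b (i + 1) → Q) :
    (coneDiff f e t (i + 1)).mulVec (Sum.elim x₁ x₂) =
      Sum.elim ((e (i + 1)).mulVec x₁ + f • x₂) (-(t i).mulVec x₁ - (e i).mulVec x₂) := by
  refine (Matrix.fromBlocks_mulVec _ _ _ _ (Sum.elim x₁ x₂)).trans ?_
  simp [Matrix.smul_mulVec, Matrix.neg_mulVec, sub_eq_add_neg]

theorem coneDiff_mulVec_top {i : ℕ} {x₁ : b (i + 1) → Q} {x₂ : b i → Q}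
    (h : (coneDiff f e t i).mulVec (Sum.elim x₁ x₂) = 0) : (e i).mulVec x₁ + f • x₂ = 0 := by
  cases i with
  | zero =>
    have := (Matrix.fromCols_mulVec (e 0) (f • (1 : Matrix (b 0) (b 0) Q))
      (Sum.elim x₁ x₂)).symm.trans h
    rw [Matrix.smul_mulVec, Matrix.one_mulVec] at this
    exact this
  | succ i =>
    rw [coneDiff_succ_mulVec] at h
    exact funext fun a => congrFun h (Sum.inl a)

theorem RingHom.map_mulVec' {m n : Type} [Fintype n] (A : Matrix m n Q) (x : n → Q) :
    π ∘ A.mulVec x = (A.map π).mulVec (π ∘ x) :=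
  funext fun i => RingHom.map_mulVec π A x i

include hπ hker hf he ht hd in
theorem isMatrixResolution_coneDiff : IsMatrixResolution (coneDiff f e t) := by
  refine ⟨coneDiff_mul hf ht, fun i x hx => ?_⟩
  · obtain ⟨x₁, x₂, rfl⟩ : ∃ (x₁ : b (i + 1) → Q) (x₂ : b i → Q), x = Sum.elim x₁ x₂ :=
      ⟨x ∘ Sum.inl, x ∘ Sum.inr, (Sum.elim_comp_inl_inr (f := x)).symm⟩
    have hx' := coneDiff_mulVec_top hx
    obtain ⟨u, hu⟩ := hd.2 i (π ∘ x₁) (by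
      rw [← he, ← RingHom.map_mulVec', eq_neg_of_add_eq_zero_left hx']
      funext a
      have : π f = 0 := by
        rw [← RingHom.mem_ker, hker]; exact Ideal.mem_span_singleton_self f
      simp [this])
    obtain ⟨u, rfl⟩ : ∃ u' : b (i + 2) → Q, u = π ∘ u' :=
      ⟨fun a => Function.surjInv hπ (u a), funext fun a => (Function.surjInv_eq hπ _).symm⟩
    rw [← he, ← RingHom.map_mulVec'] at hu
    obtain ⟨v, hv⟩ : ∃ v : b (i + 1) → Q, x₁ = (e (i + 1)).mulVec u + f • v := by
      have (a : b (i + 1)) : ∃ c, f * c = x₁ a - (e (i + 1)).mulVec u a := by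
        have : x₁ a - (e (i + 1)).mulVec u a ∈ RingHom.ker π := by
          rw [RingHom.mem_ker, map_sub, sub_eq_zero]
          exact congrFun hu a
        rw [hker, Ideal.mem_span_singleton] at this
        exact this.imp fun c hc => hc.symm
      choose c hc using this
      exact ⟨c, funext fun a => by simp [hc]⟩
    refine ⟨Sum.elim u v, ?_⟩
    have hy := coneDiff_succ_mulVec f e t i u v
    have hD : (coneDiff f e t i).mulVec ((coneDiff f e t (i + 1)).mulVec (Sum.elim u v)) = 0 := by
      exact (Matrix.mulVec_mulVec (Sum.elim u v) (coneDiff f e t i) (coneDiff f e t (i + 1))).trans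
        ((congrArg (fun M => Matrix.mulVec M (Sum.elim u v)) (coneDiff_mul hf ht i)).trans
          (Matrix.zero_mulVec _))
    rw [hy] at hD ⊢
    -- `x` and the image of `(u, v)` are cycles with the same first component `x₁`. The top row of
    -- the differential determines `f` times the second component, and `f` cancels.
    have hD' := coneDiff_mulVec_top hD
    rw [← hv] at hD' ⊢
    have h2 := hx'.trans hD'.symm
    congr 1
    funext a
    have h3 := congrFun (add_left_cancel h2) a
    simp only [Pi.smul_apply, smul_eq_mul] at h3
    exact sub_eq_zero.1 (hf _ (by rw [mul_sub, h3, sub_self]))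

omit [∀ i, DecidableEq (b i)] in
theorem extRingVanish_of_forall_matrix {S : Type u} [CommRing S]
    {D : ∀ i, Matrix (b i) (b (i + 1)) S} {i : ℕ}
    (h : ∀ G : Matrix Unit (b (i + 1)) S, G * D (i + 1) = 0 →
      ∃ Y : Matrix Unit (b i) S, G = Y * D i) : ExtRingVanish D i := by
  intro x hx
  obtain ⟨Y, hY⟩ := h (Matrix.of fun _ => x) (Matrix.ext fun _ a => congrFun hx a)
  exact ⟨Y (), funext fun a => congrFun (congrFun hY ()) a⟩

/-- A matrix with columns indexed by a positive degree of the cone. -/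
def coneRow {p : Type} {i : ℕ} (g : Matrix p (b (i + 1)) Q) (h : Matrix p (b i) Q) :
    Matrix p (coneIndex b (i + 1)) Q :=
  Matrix.fromCols g h

omit [CommRing Q] [∀ i, Fintype (b i)] [∀ i, DecidableEq (b i)] in
theorem coneRow_surjective {p : Type} {i : ℕ} (G : Matrix p (coneIndex b (i + 1)) Q) :
    ∃ (g : Matrix p (b (i + 1)) Q) (h : Matrix p (b i) Q), G = coneRow g h :=
  ⟨Matrix.toCols₁ G, Matrix.toCols₂ G, (Matrix.fromCols_toCols G).symm⟩

omit [CommRing Q] [∀ i, Fintype (b i)] [∀ i, DecidableEq (b i)] in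
theorem coneRow_inj {p : Type} {i : ℕ} {g g' : Matrix p (b (i + 1)) Q} {h h' : Matrix p (b i) Q} :
    coneRow g h = coneRow g' h' ↔ g = g' ∧ h = h' :=
  Matrix.fromCols_ext_iff _ _ _ _

omit [∀ i, Fintype (b i)] [∀ i, DecidableEq (b i)] in
theorem coneRow_add {p : Type} {i : ℕ} (g g' : Matrix p (b (i + 1)) Q) (h h' : Matrix p (b i) Q) :
    coneRow g h + coneRow g' h' = coneRow (g + g') (h + h') :=
  Matrix.ext fun _ c => by cases c <;> rfl

theorem coneRow_mul_coneDiff {p : Type} {i : ℕ} (g : Matrix p (b (i + 1)) Q)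
    (h : Matrix p (b i) Q) :
    coneRow g h * coneDiff f e t (i + 1) =
      coneRow (g * e (i + 1) - h * t i) (f • g - h * e i) := by
  refine (Matrix.fromCols_mul_fromBlocks _ _ _ _ _ _).trans ?_
  simp [coneRow, sub_eq_add_neg]

omit [∀ i, Fintype (b i)] [∀ i, DecidableEq (b i)] in
theorem smul_coneRow {p : Type} {i : ℕ} (g : Matrix p (b (i + 1)) Q) (h : Matrix p (b i) Q) :
    f • coneRow g h = coneRow (f • g) (f • h) :=
  Matrix.ext fun _ c => by cases c <;> rfl

theorem Matrix.smul_one_mul {m n : Type} [Fintype m] [DecidableEq m] (f : Q) (A : Matrix m n Q) :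
    (f • (1 : Matrix m m Q)) * A = f • A := by
  rw [Matrix.smul_mul, Matrix.one_mul]

theorem coneDiff_zero_mul {i : ℕ} (Y : Matrix (coneIndex b 1) (coneIndex b (i + 1)) Q) :
    ∃ (A : Matrix (b 1) (b (i + 1)) Q) (B : Matrix (b 1) (b i) Q)
      (C : Matrix (b 0) (b (i + 1)) Q) (D : Matrix (b 0) (b i) Q),
      coneDiff f e t 0 * Y = coneRow (e 0 * A + f • C) (e 0 * B + f • D) := by
  refine ⟨Matrix.toBlocks₁₁ Y, Matrix.toBlocks₁₂ Y, Matrix.toBlocks₂₁ Y, Matrix.toBlocks₂₂ Y, ?_⟩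
  conv_lhs => rw [← Matrix.fromBlocks_toBlocks Y]
  exact (Matrix.fromCols_mul_fromBlocks _ _ _ _ _ _).trans
    (congrArg₂ (fun M N => Matrix.fromCols (_ + M) (_ + N)) (Matrix.smul_one_mul f _)
      (Matrix.smul_one_mul f _))

theorem exists_coneDiff_zero_mul {i : ℕ} (A : Matrix (b 1) (b (i + 1)) Q)
    (B : Matrix (b 1) (b i) Q) (C : Matrix (b 0) (b (i + 1)) Q) (D : Matrix (b 0) (b i) Q) :
    ∃ Y : Matrix (coneIndex b 1) (coneIndex b (i + 1)) Q,
      coneDiff f e t 0 * Y = coneRow (e 0 * A + f • C) (e 0 * B + f • D) := by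
  refine ⟨Matrix.fromBlocks A B C D, ?_⟩
  exact (Matrix.fromCols_mul_fromBlocks _ _ _ _ _ _).trans
    (congrArg₂ (fun M N => Matrix.fromCols (_ + M) (_ + N)) (Matrix.smul_one_mul f _)
      (Matrix.smul_one_mul f _))

-- Ext^(i+2) over Q into Q is Ext^(i+1) over R into R: a cocycle `(g, h)` has `h` a cocycle modulo
-- `f`, and `h` determines `g` because `f` is a nonzerodivisor.
include hπ hker hf he ht in
theorem extRingVanish_coneDiff {i : ℕ} (h : ExtRingVanish d i) :
    ExtRingVanish (coneDiff f e t) (i + 1) := by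
  refine extRingVanish_of_forall_matrix fun G hG => ?_
  obtain ⟨g, h, rfl⟩ := coneRow_surjective G
  rw [coneRow_mul_coneDiff] at hG
  have hG' : f • g - h * e (i + 1) = 0 :=
    (coneRow_inj (g' := 0) (h' := 0).1 (hG.trans (Matrix.fromCols_zero).symm)).2
  rw [sub_eq_zero] at hG'
  obtain ⟨h', hh'⟩ := ‹ExtRingVanish d i›.exact (h.map π) (by
    rw [← he, ← Matrix.map_mul, ← hG', Matrix.map_smul_eq_zero hker])
  obtain ⟨h', rfl⟩ := Matrix.exists_map_eq hπ h'
  rw [← he, ← Matrix.map_mul] at hh'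
  obtain ⟨h'', rfl⟩ := Matrix.exists_eq_smul_of_map_eq hker hh'
  refine ⟨coneRow h'' (-h'), ?_⟩
  rw [coneRow_mul_coneDiff, coneRow_inj]
  refine ⟨Matrix.smul_left_cancel hf ?_, by rw [Matrix.neg_mul]; abel⟩
  rw [hG', Matrix.add_mul, Matrix.mul_assoc, ht, Matrix.smul_mul, Matrix.mul_smul, Matrix.neg_mul,
    sub_neg_eq_add, smul_add]
  exact add_comm _ _

omit [∀ i, DecidableEq (b i)] in
/-- Vanishing of `Ext^(i+1)` and `Ext^(i+2)` over `Q ⧸ (f)` solves the cocycle equation of the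
cone. -/
theorem ExtSyzygyVanish.exists_cone {τ : ∀ i, Matrix (b i) (b (i + 2)) R}
    (hτ : ∀ i, d i * τ (i + 1) = τ i * d (i + 2)) {i j : ℕ} (h₁ : ExtSyzygyVanish d j i)
    (h₂ : ExtSyzygyVanish d j (i + 1)) (g : Matrix (b j) (b (i + 2)) R)
    (h : Matrix (b j) (b (i + 1)) R) (Y₁ : Matrix (b (j + 1)) (b (i + 3)) R)
    (Y₂ : Matrix (b (j + 1)) (b (i + 2)) R) (hg : g * d (i + 2) - h * τ (i + 1) = d j * Y₁)
    (hh : h * d (i + 1) = d j * Y₂) :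
    ∃ (g' : Matrix (b j) (b (i + 1)) R) (h' : Matrix (b j) (b i) R)
      (Z : Matrix (b (j + 1)) (b (i + 2)) R) (Z' : Matrix (b (j + 1)) (b (i + 1)) R),
      g = g' * d (i + 1) + h' * τ i + d j * Z ∧ h = h' * d i + d j * Z' := by
  obtain ⟨h', Z', e₁⟩ := h₁ h Y₂ hh
  obtain ⟨g', Z, e₂⟩ := h₂ (g - h' * τ i) (Y₁ + Z' * τ (i + 1)) (by
    rw [Matrix.sub_mul, Matrix.mul_add, ← hg, Matrix.mul_assoc h', ← hτ, e₁, Matrix.add_mul,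
      Matrix.mul_assoc, Matrix.mul_assoc]
    abel)
  exact ⟨g', h', Z, Z', by rw [sub_eq_iff_eq_add] at e₂; rw [e₂]; abel, e₁⟩

omit [∀ i, DecidableEq (b i)] in
include hf he ht in
theorem map_cone_comm (i : ℕ) : d i * (t (i + 1)).map π = (t i).map π * d (i + 2) := by
  rw [← he, ← he, ← Matrix.map_mul, ← Matrix.map_mul, cone_comm hf ht]

-- In the change of rings sequence, Ext^(i+2)_Q(M, M) lies between Ext^(i+2)_R(M, M) and
-- Ext^(i+1)_R(M, M).
include hπ hker hf he ht in
theorem extSyzygyVanish_coneDiff {i : ℕ} (h₁ : ExtSyzygyVanish d 0 i)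
    (h₂ : ExtSyzygyVanish d 0 (i + 1)) : ExtSyzygyVanish (coneDiff f e t) 0 (i + 1) := by
  intro G Y hG
  obtain ⟨g, h, rfl⟩ := coneRow_surjective (p := b 0) G
  obtain ⟨A, B, C, D, hY⟩ := coneDiff_zero_mul (f := f) (e := e) (t := t) Y
  have hG := (coneRow_mul_coneDiff g h).symm.trans (hG.trans hY)
  rw [coneRow_inj] at hG
  obtain ⟨hg, hh⟩ := hG
  have hfz {m n : Type} (A : Matrix m n Q) := Matrix.map_smul_eq_zero hker A
  obtain ⟨g', h', Z, Z', e₁, e₂⟩ := h₁.exists_cone (τ := fun i => (t i).map π) (map_cone_comm hf he ht) h₂ (g.map π)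
    (h.map π) (A.map π) (-B.map π) (by
      have := congrArg (fun M => Matrix.map M π) hg
      simpa [Matrix.map_sub, Matrix.map_add, Matrix.map_mul, he, hfz] using this) (by
      have := congrArg (fun M => -Matrix.map M π) hh
      simpa [Matrix.map_sub, Matrix.map_add, Matrix.map_mul, he, hfz] using this)
  obtain ⟨g', rfl⟩ := Matrix.exists_map_eq hπ g'
  obtain ⟨h', rfl⟩ := Matrix.exists_map_eq hπ h'
  obtain ⟨Z, rfl⟩ := Matrix.exists_map_eq hπ Z
  obtain ⟨Z', rfl⟩ := Matrix.exists_map_eq hπ Z'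
  obtain ⟨W, hW⟩ := Matrix.exists_eq_smul_of_map_eq hker (A := g)
    (B := g' * e (i + 1) + h' * t i + e 0 * Z) (by
      simpa [Matrix.map_add, Matrix.map_mul, he] using e₁)
  obtain ⟨W', hW'⟩ := Matrix.exists_eq_smul_of_map_eq hker (A := h)
    (B := h' * e i + e 0 * Z') (by simpa [Matrix.map_add, Matrix.map_mul, he] using e₂)
  -- The row `(g', -h')` contributes `f • g'` to the second component; `W' - g'` compensates for it.
  obtain ⟨V, hV⟩ := exists_coneDiff_zero_mul (f := f) (e := e) (t := t) Z Z' W (W' - g')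
  refine ⟨coneRow (p := b 0) g' (-h'), V, ?_⟩
  rw [hV]
  refine Eq.trans ?_ (congrArg (fun M : Matrix (b 0) (coneIndex b (i + 2)) Q => M + _)
    (coneRow_mul_coneDiff g' (-h')).symm)
  refine Eq.trans ?_ (coneRow_add _ _ _ _).symm
  refine coneRow_inj.2 ⟨?_, ?_⟩
  · rw [hW, Matrix.neg_mul]; abel
  · rw [hW', Matrix.neg_mul, smul_sub]; abel

include hπ hker he in
/-- Over a split cone, multiplication by `t` is injective on cohomology. -/
theorem exists_eq_of_contraction {i j : ℕ}
    {H : Matrix (coneIndex b (i + 2)) (coneIndex b (i + 1)) Q}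
    {K : Matrix (coneIndex b (i + 3)) (coneIndex b (i + 2)) Q}
    (hHK : H * coneDiff f e t (i + 1) + coneDiff f e t (i + 2) * K = 1)
    (h : Matrix (b j) (b (i + 1)) R) (Y' : Matrix (b (j + 1)) (b (i + 2)) R)
    (hh : h * d (i + 1) = d j * Y') (g : Matrix (b j) (b (i + 2)) R)
    (Y : Matrix (b (j + 1)) (b (i + 3)) R)
    (hg : h * (t (i + 1)).map π = g * d (i + 2) + d j * Y) :
    ∃ (u : Matrix (b j) (b i) R) (V : Matrix (b (j + 1)) (b (i + 1)) R), h = u * d i + d j * V := by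
  have hfz {m n : Type} (A : Matrix m n Q) := Matrix.map_smul_eq_zero hker A
  obtain ⟨g, rfl⟩ := Matrix.exists_map_eq hπ g
  obtain ⟨h, rfl⟩ := Matrix.exists_map_eq hπ h
  obtain ⟨Y, rfl⟩ := Matrix.exists_map_eq hπ Y
  obtain ⟨Y', rfl⟩ := Matrix.exists_map_eq hπ Y'
  obtain ⟨A, hA⟩ := Matrix.exists_eq_smul_of_map_eq hker (A := h * t (i + 1))
    (B := g * e (i + 2) + e j * Y) (by simpa [Matrix.map_add, Matrix.map_mul, he] using hg)
  obtain ⟨B, hB⟩ := Matrix.exists_eq_smul_of_map_eq hker (A := h * e (i + 1))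
    (B := e j * Y') (by simpa [Matrix.map_add, Matrix.map_mul, he] using hh)
  -- The relation expressing that `h * t` is a coboundary makes `(g, h)` a cocycle of the cone with
  -- values in the cokernel of `d j`. The contraction turns it into a coboundary, whose second
  -- component modulo `f` bounds `h`.
  have hG : coneRow g h * coneDiff f e t (i + 2) =
      e j * coneRow (-Y) (-Y') + f • coneRow (-A) (g - B) := by
    rw [coneRow_mul_coneDiff, hA, hB]
    refine Eq.trans ?_ (congrArg (fun M : Matrix (b j) (coneIndex b (i + 3)) Q => M + _)
      (Matrix.mul_fromCols (e j) (-Y) (-Y')).symm)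
    refine Eq.trans ?_ (congrArg (fun M : Matrix (b j) (coneIndex b (i + 3)) Q => _ + M)
      (smul_coneRow (-A) (g - B)).symm)
    refine Eq.trans ?_ (coneRow_add _ _ _ _).symm
    rw [coneRow_inj]
    constructor
    · simp; abel
    · simp [smul_sub]; abel
  have key : coneRow g h = coneRow g h * H * coneDiff f e t (i + 1) +
      (e j * (coneRow (-Y) (-Y') * K) + f • (coneRow (-A) (g - B) * K)) := by
    rw [← Matrix.mul_assoc, ← Matrix.smul_mul, ← Matrix.add_mul, ← hG, Matrix.mul_assoc,
      Matrix.mul_assoc, ← Matrix.mul_add, hHK, Matrix.mul_one]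
  obtain ⟨u₁, u₂, hu⟩ := coneRow_surjective (coneRow g h * H)
  obtain ⟨v₁, v₂, hv⟩ := coneRow_surjective (coneRow (-Y) (-Y') * K)
  obtain ⟨w₁, w₂, hw⟩ := coneRow_surjective (coneRow (-A) (g - B) * K)
  have key' : coneRow g h = coneRow (u₁ * e (i + 1) - u₂ * t i) (f • u₁ - u₂ * e i) +
      (coneRow (e j * v₁) (e j * v₂) + coneRow (f • w₁) (f • w₂)) := by
    rw [← coneRow_mul_coneDiff, ← hu, ← smul_coneRow, ← hw]
    refine key.trans (congrArg (_ + ·) (congrArg (· + _) ?_))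
    rw [hv]
    exact Matrix.mul_fromCols _ _ _
  rw [coneRow_add, coneRow_add, coneRow_inj] at key'
  refine ⟨-u₂.map π, v₂.map π, ?_⟩
  have := congrArg (fun M => Matrix.map M π) key'.2
  simpa [Matrix.map_sub, Matrix.map_add, Matrix.map_mul, he, hfz] using this

-- Splitting of the cone makes `t` injective beyond `s` for all syzygy coefficients at once, so
-- vanishing in high degrees comes down to degrees bounded by `s` alone.
include hπ hker hf he ht hd in
theorem SplitsAt.of_coneDiff {s n : ℕ} (hs : SplitsAt (coneDiff f e t) s)
    (hR : ∀ i, n ≤ i → ExtRingVanish d i) (hM : ∀ i, n ≤ i → ExtSyzygyVanish d 0 i) :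
    SplitsAt d s := by
  have hcone := isMatrixResolution_coneDiff hπ hf hker hd he ht
  -- `k` counts applications of `t`, each raising the degree by two, until the range `n + j ≤ i` of
  -- known vanishing is reached.
  have key (j k : ℕ) : ∀ i, s ≤ i → n + j ≤ i + 2 * k → ExtSyzygyVanish d j i := by
    induction k with
    | zero => exact fun i _ hi => ExtSyzygyVanish.add hd hR hM j i hi
    | succ k ih =>
      intro i hi hk h Y hh
      obtain ⟨g, Y', hg⟩ := ih (i + 2) (by omega) (by omega) (h * (t (i + 1)).map π)
        (Y * (t (i + 2)).map π) (by
          rw [Matrix.mul_assoc, ← map_cone_comm hf he ht, ← Matrix.mul_assoc, hh, Matrix.mul_assoc])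
      obtain ⟨H, K, hHK⟩ := (hs.mono hcone (show s ≤ i + 1 by omega)).contraction hcone
      exact exists_eq_of_contraction hπ hker he hHK h Y hh g Y' hg
  -- The cocycle `1` represents the projection onto `coker (d (s + 1))`; `n + 1` applications
  -- suffice since `n + (s + 1) ≤ s + 2 * (n + 1)`.
  obtain ⟨H, Z, hH⟩ := key (s + 1) (n + 1) s le_rfl (by omega) 1 1 (by
    rw [Matrix.one_mul, Matrix.mul_one])
  refine ⟨H, ?_⟩
  have := congrArg (d s * ·) hH
  simpa [Matrix.mul_add, ← Matrix.mul_assoc, hd.1] using this.symm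

end Cone

/-! ### Descent from Q to its quotient by a regular sequence. -/

theorem MatrixAR.of_surjective {Q : Type w} [CommRing Q] {R : Type v} [CommRing R] {π : Q →+* R}
    (hπ : Function.Surjective π) {f : Q} (hf : ∀ x, f * x = 0 → x = 0)
    (hker : RingHom.ker π = Ideal.span {f}) (hQ : MatrixAR Q) : MatrixAR R := by
  intro b _ _ d hd n hR hM
  choose e he using fun i => Matrix.exists_map_eq hπ (d i)
  have ht (i : ℕ) : ∃ t, e i * e (i + 1) = 0 + f • t :=
    Matrix.exists_eq_smul_of_map_eq hker (by simp [Matrix.map_mul, he, hd.1])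
  simp only [zero_add] at ht
  choose t ht using ht
  obtain ⟨s, hs⟩ := hQ (coneIndex b) (coneDiff f e t) (isMatrixResolution_coneDiff hπ hf hker hd he ht)
    (n + 1)
    (fun i hi => by
      obtain ⟨i, rfl⟩ : ∃ k, i = k + 1 := ⟨i - 1, by omega⟩
      exact extRingVanish_coneDiff hπ hf hker he ht (hR i (by omega)))
    (fun i hi => by
      obtain ⟨i, rfl⟩ : ∃ k, i = k + 1 := ⟨i - 1, by omega⟩
      exact extSyzygyVanish_coneDiff hπ hf hker he ht (hM i (by omega)) (hM _ (by omega)))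
  exact ⟨s, hs.of_coneDiff hπ hf hker hd he ht hR hM⟩

theorem MatrixAR.of_ringEquiv {Q : Type w} [CommRing Q] {R : Type v} [CommRing R] (σ : Q ≃+* R)
    (hQ : MatrixAR Q) : MatrixAR R := by
  intro b _ _ d hd n hR hM
  have mapσ {m n : Type} (A : Matrix m n R) : (A.map σ.symm).map σ = A :=
    Matrix.ext fun i j => by simp
  have mapσ' {m n : Type} (A : Matrix m n Q) : (A.map σ).map σ.symm = A :=
    Matrix.ext fun i j => by simp
  have mapmul {l m n : Type} [Fintype m] (A : Matrix l m R) (B : Matrix m n R) :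
      (A * B).map σ.symm = A.map σ.symm * B.map σ.symm := Matrix.map_mul (f := (σ.symm : R →+* Q))
  have mapmul' {l m n : Type} [Fintype m] (A : Matrix l m Q) (B : Matrix m n Q) :
      (A * B).map σ = A.map σ * B.map σ := Matrix.map_mul (f := (σ : Q →+* R))
  have mapadd {m n : Type} (A B : Matrix m n R) :
      (A + B).map σ.symm = A.map σ.symm + B.map σ.symm := Matrix.map_add _ (by simp) _ _
  have key : ∃ s, SplitsAt (fun i => (d i).map σ.symm) s := by
    refine hQ b _ ⟨fun i => ?_, fun i x hx => ?_⟩ n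
      (fun i hi => extRingVanish_of_forall_matrix fun G hG => ?_) (fun i hi G Y hG => ?_)
    · rw [← mapmul, hd.1]
      exact Matrix.map_zero _ (map_zero _)
    · obtain ⟨y, hy⟩ := hd.2 i (σ ∘ x) (by
        rw [← mapσ (d i)]
        exact (RingHom.map_mulVec' (π := (σ : Q →+* R)) _ x).symm.trans (by
          rw [hx]; funext a; simp))
      refine ⟨σ.symm ∘ y, ?_⟩
      have h1 := RingHom.map_mulVec' (π := (σ.symm : R →+* Q)) (d (i + 1)) y
      refine Eq.trans ?_ h1
      rw [← hy]
      funext a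
      simp
    · obtain ⟨Y, hY⟩ := (hR i hi).exact (G.map σ) (by
        rw [← mapσ (d (i + 1)), ← mapmul', hG]
        exact Matrix.map_zero _ (map_zero _))
      refine ⟨Y.map σ.symm, ?_⟩
      rw [← mapmul, ← hY, mapσ']
    · obtain ⟨H, Z, hH⟩ := hM i hi (G.map σ) (Y.map σ) (by
        rw [← mapσ (d (i + 1)), ← mapmul', hG, mapmul', mapσ])
      refine ⟨H.map σ.symm, Z.map σ.symm, ?_⟩
      rw [← mapmul, ← mapmul, ← mapadd, ← hH, mapσ']
  obtain ⟨s, h, hs⟩ := key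
  refine ⟨s, h.map σ, ?_⟩
  have := congrArg (fun M => Matrix.map M σ) hs
  simpa only [mapmul', mapσ] using this

theorem MatrixAR.of_isWeaklyRegular_length {R : Type v} [CommRing R] (l : ℕ) :
    ∀ {Q : Type w} [CommRing Q] (π : Q →+* R) (_ : Function.Surjective π)
    (fs : List Q) (_ : fs.length = l) (_ : RingTheory.Sequence.IsWeaklyRegular Q fs)
    (_ : RingHom.ker π = Ideal.ofList fs) (_ : MatrixAR Q), MatrixAR R := by
  induction l with
  | zero =>
    intro Q _ π hπ fs hl _ hker hQ
    rw [List.length_eq_zero_iff] at hl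
    subst hl
    rw [Ideal.ofList_nil, ← RingHom.injective_iff_ker_eq_bot] at hker
    exact hQ.of_ringEquiv (RingEquiv.ofBijective π ⟨hker, hπ⟩)
  | succ l ih =>
    intro Q _ π hπ fs hl hreg hker hQ
    obtain ⟨f, fs, rfl⟩ : ∃ f gs, fs = f :: gs := List.exists_cons_of_length_eq_add_one hl
    rw [RingTheory.Sequence.isWeaklyRegular_cons_iff'] at hreg
    have hfs : f ∈ RingHom.ker π := by
      rw [hker]; exact Ideal.subset_span (by simp)
    have hle : Ideal.span {f} ≤ RingHom.ker π := by
      rwa [Ideal.span_singleton_le_iff_mem]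
    -- The target R stays fixed while Q is replaced by Q/(f), over which the remaining sequence is
    -- weakly regular.
    refine ih (Ideal.Quotient.lift (Ideal.span {f}) π hle)
      (Ideal.Quotient.lift_surjective_of_surjective _ _ hπ)
      (fs.map (Ideal.Quotient.mk (Ideal.span {f}))) (by simpa using hl) ?_ ?_ ?_
    · refine (LinearEquiv.isWeaklyRegular_congr ?_ _).1 hreg.2
      have e : QuotSMulTop f Q ≃ₗ[Q] (Q ⧸ Ideal.span {f}) := Submodule.quotEquivOfEq _ _ (by
        rw [← Submodule.ideal_span_singleton_smul, smul_eq_mul, Ideal.mul_top])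
      exact e.extendScalarsOfSurjective Ideal.Quotient.mk_surjective
    · rw [Ideal.ker_quotient_lift, hker, ← Ideal.map_ofList, Ideal.ofList_cons, Ideal.map_sup,
        Ideal.map_quotient_self, bot_sup_eq]
    · exact hQ.of_surjective (π := Ideal.Quotient.mk (Ideal.span {f})) Ideal.Quotient.mk_surjective
        (fun x hx => hreg.1 (by simpa using hx)) (Ideal.mk_ker)

theorem MatrixAR.of_isWeaklyRegular {R : Type v} [CommRing R] {Q : Type w} [CommRing Q]
    (hQ : MatrixAR Q) {π : Q →+* R} (hπ : Function.Surjective π) {fs : List Q}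
    (hreg : RingTheory.Sequence.IsWeaklyRegular Q fs) (hker : RingHom.ker π = Ideal.ofList fs) :
    MatrixAR R :=
  MatrixAR.of_isWeaklyRegular_length fs.length π hπ fs rfl hreg hker hQ

/-! ### Matrices with entries in a module. -/

section ModuleMatrix

variable {R : Type u} [CommRing R] {X : Type v} [AddCommGroup X] [Module R X]
  {l m n p : Type}

/-- Left multiplication of a matrix with entries in a module by a matrix over the ring. -/
def Matrix.smulLeft [Fintype n] (A : Matrix m n R) : Matrix n p X →ₗ[R] Matrix m p X where
  toFun G := Matrix.of fun i k => ∑ j, A i j • G j k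
  map_add' G H := Matrix.ext fun i k => by simp [Finset.sum_add_distrib]
  map_smul' r G := Matrix.ext fun i k => by simp [Finset.smul_sum, smul_comm r]

/-- Right multiplication of a matrix with entries in a module by a matrix over the ring. -/
def Matrix.smulRight [Fintype n] (A : Matrix n p R) : Matrix m n X →ₗ[R] Matrix m p X where
  toFun G := Matrix.of fun i k => ∑ j, A j k • G i j
  map_add' G H := Matrix.ext fun i k => by simp [Finset.sum_add_distrib]
  map_smul' r G := Matrix.ext fun i k => by simp [Finset.smul_sum, smul_comm r]

theorem Matrix.smulLeft_apply [Fintype n] (A : Matrix m n R) (G : Matrix n p X) (i : m) (k : p) :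
    A.smulLeft G i k = ∑ j, A i j • G j k := rfl

theorem Matrix.smulRight_apply [Fintype n] (A : Matrix n p R) (G : Matrix m n X) (i : m) (k : p) :
    A.smulRight G i k = ∑ j, A j k • G i j := rfl

theorem Matrix.smulLeft_mul [Fintype m] [Fintype n] (A : Matrix l m R) (B : Matrix m n R)
    (G : Matrix n p X) : (A * B).smulLeft G = A.smulLeft (B.smulLeft G) := by
  ext i k
  simp only [smulLeft_apply, Matrix.mul_apply, Finset.sum_smul, Finset.smul_sum, mul_smul]
  exact Finset.sum_comm

theorem Matrix.smulRight_mul [Fintype m] [Fintype n] (A : Matrix m n R) (B : Matrix n p R)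
    (G : Matrix l m X) : (A * B).smulRight G = B.smulRight (A.smulRight G) := by
  ext i k
  simp only [smulRight_apply, Matrix.mul_apply, Finset.sum_smul, Finset.smul_sum]
  rw [Finset.sum_comm]
  simp only [← mul_smul, mul_comm]

theorem Matrix.smulLeft_smulRight [Fintype m] [Fintype n] (A : Matrix l m R) (B : Matrix n p R)
    (G : Matrix m n X) : A.smulLeft (B.smulRight G) = B.smulRight (A.smulLeft G) := by
  ext i k
  simp only [smulLeft_apply, smulRight_apply, Finset.smul_sum]
  rw [Finset.sum_comm]
  simp only [← mul_smul, mul_comm]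

@[simp]
theorem Matrix.zero_smulLeft [Fintype n] (G : Matrix n p X) :
    (0 : Matrix m n R).smulLeft G = 0 := by
  ext i k; simp [smulLeft_apply]

@[simp]
theorem Matrix.zero_smulRight [Fintype n] (G : Matrix m n X) :
    (0 : Matrix n p R).smulRight G = 0 := by
  ext i k; simp [smulRight_apply]

variable {Y : Type w} [AddCommGroup Y] [Module R Y]

theorem Matrix.smulLeft_map [Fintype n] (A : Matrix m n R) (G : Matrix n p X) (f : X →ₗ[R] Y) :
    (A.smulLeft G).map f = A.smulLeft (G.map f) := by
  ext i k; simp [smulLeft_apply]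

theorem Matrix.smulRight_map [Fintype n] (A : Matrix n p R) (G : Matrix m n X) (f : X →ₗ[R] Y) :
    (A.smulRight G).map f = A.smulRight (G.map f) := by
  ext i k; simp [smulRight_apply]

theorem Matrix.exists_map_linearMap_eq {f : X →ₗ[R] Y} (hf : Function.Surjective f)
    (G : Matrix m n Y) : ∃ H : Matrix m n X, H.map f = G :=
  ⟨G.map (Function.surjInv hf), Matrix.ext fun _ _ => Function.surjInv_eq hf _⟩

theorem Matrix.exists_map_eq_of_exact {Z : Type*} [AddCommGroup Z] [Module R Z] {f : X →ₗ[R] Y}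
    {g : Y →ₗ[R] Z} (h : Function.Exact f g) (G : Matrix m n Y) (hG : G.map g = 0) :
    ∃ H : Matrix m n X, G = H.map f := by
  have (i : m) (j : n) : ∃ x, f x = G i j := (h _).1 (congrFun (congrFun hG i) j)
  choose H hH using this
  exact ⟨Matrix.of H, Matrix.ext fun i j => (hH i j).symm⟩

theorem Matrix.map_linearMap_injective {f : X →ₗ[R] Y} (hf : Function.Injective f) :
    Function.Injective fun G : Matrix m n X => G.map f :=
  Matrix.map_injective hf

theorem Matrix.smulLeft_eq_mul {S : Type v} [CommRing S] [Algebra R S] [Fintype n]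
    (A : Matrix m n R) (G : Matrix n p S) :
    A.smulLeft G = A.map (algebraMap R S) * G := by
  ext i k; simp [smulLeft_apply, Matrix.mul_apply, Algebra.smul_def]

theorem Matrix.smulRight_eq_mul {S : Type v} [CommRing S] [Algebra R S] [Fintype n]
    (A : Matrix n p R) (G : Matrix m n S) :
    A.smulRight G = G * A.map (algebraMap R S) := by
  ext i k; simp [smulRight_apply, Matrix.mul_apply, Algebra.smul_def, mul_comm]

/-- A solution of a finite system of linear equations in a flat module is a combination of
solutions in the ring. -/
theorem Module.Flat.exists_solutions [Module.Flat R X] {ι κ : Type} [Fintype ι] [Fintype κ]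
    [DecidableEq ι] [DecidableEq κ] (A : Matrix κ ι R) (x : ι → X)
    (hx : ∀ k, ∑ i, A k i • x i = 0) :
    ∃ (N : ℕ) (S : Fin N → ι → R) (z : Fin N → X),
      (∀ i, x i = ∑ l, S l i • z l) ∧ ∀ l k, ∑ i, A k i * S l i = 0 := by
  obtain ⟨N, a, y, h₁, h₂⟩ := Module.Flat.exists_factorization_of_comp_eq_zero_of_free
    (f := A.transpose.mulVecLin) (x := Fintype.linearCombination R x) (by
      ext k
      simpa [Fintype.linearCombination_apply, Matrix.mulVec_single] using hx k)
  refine ⟨N, fun l i => a (Pi.single i 1) l, fun l => y (Finsupp.single l 1), fun i => ?_,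
    fun l k => ?_⟩
  · have := LinearMap.congr_fun h₁ (Pi.single i 1)
    simp only [Fintype.linearCombination_apply_single, one_smul, LinearMap.comp_apply] at this
    rw [this]
    conv_lhs => rw [← Finsupp.univ_sum_single (a (Pi.single i 1))]
    simp only [map_sum, ← map_smul, Finsupp.smul_single, smul_eq_mul, mul_one]
  · have := DFunLike.congr_fun (LinearMap.congr_fun h₂ (Pi.single k 1)) l
    simp only [LinearMap.comp_apply, Matrix.mulVecLin_apply, Matrix.mulVec_single_one,
      LinearMap.zero_apply, Finsupp.zero_apply] at this
    have hk : A.transpose.col k = ∑ i, A k i • Pi.single i (1 : R) := by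
      funext i; simp [Finset.sum_apply, Pi.single_apply]
    rw [hk] at this
    simpa using this

end ModuleMatrix

/-! ### Coefficients in modules of finite flat dimension. -/

section ExactCoefficients

variable {R : Type u} [CommRing R] {b : ℕ → Type} [∀ i, Fintype (b i)] [∀ i, DecidableEq (b i)]

/-- The complex of matrices `d` behaves over the module `X` as over the ring: vanishing of
`Tor_(i+1)(M, X)` for `k ≤ i`, of `Ext^(i+1)(M, X)` for `n ≤ i`, and of
`Ext^(i+1)(M, coker (d j) ⊗ X)` for `k ≤ j` and `n + j ≤ i`. -/
structure ExactCoefficients (d : ∀ i, Matrix (b i) (b (i + 1)) R) (n : ℕ)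
    (X : Type v) [AddCommGroup X] [Module R X] (k : ℕ) : Prop where
  tor : ∀ i, k ≤ i → ∀ (p : Type) (G : Matrix (b (i + 1)) p X), (d i).smulLeft G = 0 →
    ∃ Y : Matrix (b (i + 2)) p X, G = (d (i + 1)).smulLeft Y
  ext : ∀ i, n ≤ i → ∀ (p : Type) (G : Matrix p (b (i + 1)) X), (d (i + 1)).smulRight G = 0 →
    ∃ Y : Matrix p (b i) X, G = (d i).smulRight Y
  extSyzygy : ∀ j, k ≤ j → ∀ i, n + j ≤ i → ∀ (G : Matrix (b j) (b (i + 1)) X)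
    (Y : Matrix (b (j + 1)) (b (i + 2)) X), (d (i + 1)).smulRight G = (d j).smulLeft Y →
    ∃ (H : Matrix (b j) (b i) X) (Z : Matrix (b (j + 1)) (b (i + 1)) X),
      G = (d i).smulRight H + (d j).smulLeft Z

variable {d : ∀ i, Matrix (b i) (b (i + 1)) R} {n : ℕ}

omit [∀ i, DecidableEq (b i)] in
theorem ExactCoefficients.of_subsingleton (X : Type v) [AddCommGroup X] [Module R X]
    [Subsingleton X] (k : ℕ) : ExactCoefficients d n X k where
  tor _ _ _ _ _ := ⟨0, Subsingleton.elim _ _⟩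
  ext _ _ _ _ _ := ⟨0, Subsingleton.elim _ _⟩
  extSyzygy _ _ _ _ _ _ _ := ⟨0, 0, Subsingleton.elim _ _⟩

/-- Each condition says that solutions of one finite linear system over R come from another. By the
equational criterion, a solution in a flat module is a combination of solutions in R. -/
theorem ExactCoefficients.of_flat (hd : IsMatrixResolution d)
    (hR : ∀ i, n ≤ i → ExtRingVanish d i) (hM : ∀ i, n ≤ i → ExtSyzygyVanish d 0 i)
    (X : Type v) [AddCommGroup X] [Module R X] [Module.Flat R X] (k : ℕ) :
    ExactCoefficients d n X k where
  tor i _ p G hG := by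
    have (c : p) : ∃ y : b (i + 2) → X, ∀ a, G a c = ∑ a', d (i + 1) a a' • y a' := by
      obtain ⟨N, S, z, h₁, h₂⟩ := Module.Flat.exists_solutions (d i) (fun a => G a c)
        (fun a => congrFun (congrFun hG a) c)
      have (l : Fin N) := hd.2 i (S l) (funext fun a => h₂ l a)
      choose y hy using this
      refine ⟨fun a' => ∑ l, y l a' • z l, fun a => ?_⟩
      simp only [h₁, Finset.smul_sum]
      rw [Finset.sum_comm]
      refine Finset.sum_congr rfl fun l _ => ?_
      rw [hy]
      simp only [Matrix.mulVec, dotProduct, Finset.sum_smul, mul_smul]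
    choose y hy using this
    exact ⟨Matrix.of fun a' c => y c a', Matrix.ext fun a c => hy c a⟩
  ext i hi p G hG := by
    have (c : p) : ∃ y : b i → X, ∀ a, G c a = ∑ a', d i a' a • y a' := by
      obtain ⟨N, S, z, h₁, h₂⟩ := Module.Flat.exists_solutions (d (i + 1)).transpose (fun a => G c a)
        (fun a => congrFun (congrFun hG c) a)
      have (l : Fin N) := hR i hi (S l) (funext fun a => by
        simpa [Matrix.vecMul, dotProduct, mul_comm] using h₂ l a)
      choose y hy using this
      refine ⟨fun a' => ∑ l, y l a' • z l, fun a => ?_⟩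
      simp only [h₁, Finset.smul_sum]
      rw [Finset.sum_comm]
      refine Finset.sum_congr rfl fun l _ => ?_
      rw [hy]
      simp only [Matrix.vecMul, dotProduct, Finset.sum_smul, ← mul_smul, mul_comm]
    choose y hy using this
    exact ⟨Matrix.of y, Matrix.ext fun c a => hy c a⟩
  extSyzygy j _ i hi G Y hG := by
    -- The matrix equation `G * d (i + 1) = d j * Y` is one linear system in the entries of `G` and
    -- `Y` together, with one equation per entry.
    obtain ⟨N, S, z, h₁, h₂⟩ := Module.Flat.exists_solutions
      (ι := (b j × b (i + 1)) ⊕ (b (j + 1) × b (i + 2))) (κ := b j × b (i + 2))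
      (Matrix.of fun k => Sum.elim (fun a => if a.1 = k.1 then d (i + 1) a.2 k.2 else 0)
        fun a => if a.2 = k.2 then -d j k.1 a.1 else 0)
      (Sum.elim (fun a => G a.1 a.2) fun a => Y a.1 a.2) (fun k => by
        have := congrFun (congrFun hG k.1) k.2
        simp only [Matrix.smulLeft_apply, Matrix.smulRight_apply] at this
        simp [Fintype.sum_sum_type, Fintype.sum_prod_type, ite_smul, this, Finset.sum_ite_irrel])
    have (l : Fin N) := ExtSyzygyVanish.add hd hR hM j i hi
      (Matrix.of fun a c => S l (Sum.inl (a, c))) (Matrix.of fun a c => S l (Sum.inr (a, c)))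
      (Matrix.ext fun a c => by
        have := h₂ l (a, c)
        simp only [Fintype.sum_sum_type, Fintype.sum_prod_type, Matrix.of_apply, Sum.elim_inl,
          Sum.elim_inr, ite_mul, zero_mul, neg_mul, Finset.sum_ite_irrel, Finset.sum_const_zero,
          Finset.sum_ite_eq', Finset.mem_univ, if_true, Finset.sum_neg_distrib] at this
        rw [add_neg_eq_zero] at this
        simpa [Matrix.mul_apply, mul_comm] using this)
    choose H Z hHZ using this
    refine ⟨Matrix.of fun a c => ∑ l, H l a c • z l, Matrix.of fun a c => ∑ l, Z l a c • z l,
      Matrix.ext fun a c => ?_⟩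
    have hG' := h₁ (Sum.inl (a, c))
    simp only [Sum.elim_inl] at hG'
    rw [hG', Matrix.add_apply, Matrix.smulRight_apply, Matrix.smulLeft_apply]
    simp only [Matrix.of_apply, Finset.smul_sum]
    rw [Finset.sum_comm, Finset.sum_comm (s := Finset.univ (α := b (j + 1))),
      ← Finset.sum_add_distrib]
    refine Finset.sum_congr rfl fun l _ => ?_
    have := congrFun (congrFun (hHZ l) a) c
    simp only [Matrix.of_apply, Matrix.add_apply, Matrix.mul_apply] at this
    rw [this, add_smul, Finset.sum_smul, Finset.sum_smul]
    simp only [← mul_smul, mul_comm]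

-- These are the long exact sequences of 0 → A → F → X → 0. Tor shifts down in A, which costs one in
-- `k`; Ext shifts up, so `n` is unchanged.
omit [∀ i, DecidableEq (b i)] in
theorem ExactCoefficients.of_exact (hd : IsMatrixResolution d) {A : Type v} [AddCommGroup A]
    [Module R A] {F : Type w} [AddCommGroup F] [Module R F] {X : Type*} [AddCommGroup X]
    [Module R X] {f : A →ₗ[R] F} {q : F →ₗ[R] X} (hf : Function.Injective f)
    (hfq : Function.Exact f q) (hq : Function.Surjective q) {k : ℕ}
    (hA : ExactCoefficients d n A k) (hF : ExactCoefficients d n F k) :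
    ExactCoefficients d n X (k + 1) := by
  have hfq0 {m p : Type} (G : Matrix m p A) : (G.map f).map q = 0 :=
    Matrix.ext fun i j => hfq.apply_apply_eq_zero _
  have hmapz {m p : Type} {V W : Type _} [AddCommGroup V] [Module R V] [AddCommGroup W]
    [Module R W] (f : V →ₗ[R] W) : (0 : Matrix m p V).map f = 0 := Matrix.map_zero _ (map_zero f)
  have hinj {m p : Type} {G : Matrix m p A} (hG : G.map f = 0) : G = 0 :=
    Matrix.map_linearMap_injective hf (hG.trans (hmapz f).symm)
  have tor : ∀ i, k + 1 ≤ i → ∀ (p : Type) (G : Matrix (b (i + 1)) p X), (d i).smulLeft G = 0 →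
      ∃ Y : Matrix (b (i + 2)) p X, G = (d (i + 1)).smulLeft Y := by
    intro i hi p G hG
    obtain ⟨i, rfl⟩ : ∃ k, i = k + 1 := ⟨i - 1, by omega⟩
    obtain ⟨G, rfl⟩ := Matrix.exists_map_linearMap_eq hq G
    obtain ⟨W, hW⟩ := Matrix.exists_map_eq_of_exact hfq ((d (i + 1)).smulLeft G) (by
      rw [Matrix.smulLeft_map, hG])
    obtain ⟨V, rfl⟩ := hA.tor i (by omega) p W (hinj (by
      rw [Matrix.smulLeft_map, ← hW, ← Matrix.smulLeft_mul, hd.1, Matrix.zero_smulLeft]))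
    obtain ⟨U, hU⟩ := hF.tor (i + 1) (by omega) p (G - V.map f) (by
      rw [map_sub, hW, Matrix.smulLeft_map, sub_self])
    refine ⟨U.map q, ?_⟩
    rw [← Matrix.smulLeft_map, ← hU, Matrix.map_sub _ (map_sub q), hfq0, sub_zero]
  refine ⟨tor, fun i hi p G hG => ?_, fun j hj i hi G Y hG => ?_⟩
  · obtain ⟨G, rfl⟩ := Matrix.exists_map_linearMap_eq hq G
    obtain ⟨W, hW⟩ := Matrix.exists_map_eq_of_exact hfq ((d (i + 1)).smulRight G) (by
      rw [Matrix.smulRight_map, hG])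
    obtain ⟨V, rfl⟩ := hA.ext (i + 1) (by omega) p W (hinj (by
      rw [Matrix.smulRight_map, ← hW, ← Matrix.smulRight_mul, hd.1, Matrix.zero_smulRight]))
    obtain ⟨U, hU⟩ := hF.ext i hi p (G - V.map f) (by
      rw [map_sub, hW, Matrix.smulRight_map, sub_self])
    refine ⟨U.map q, ?_⟩
    rw [← Matrix.smulRight_map, ← hU, Matrix.map_sub _ (map_sub q), hfq0, sub_zero]
  · obtain ⟨V, hV⟩ := tor j hj _ ((d (i + 2)).smulRight Y) (by
      rw [Matrix.smulLeft_smulRight, ← hG, ← Matrix.smulRight_mul, hd.1, Matrix.zero_smulRight])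
    obtain ⟨G, rfl⟩ := Matrix.exists_map_linearMap_eq hq G
    obtain ⟨Y, rfl⟩ := Matrix.exists_map_linearMap_eq hq Y
    obtain ⟨V, rfl⟩ := Matrix.exists_map_linearMap_eq hq V
    obtain ⟨W, hW⟩ := Matrix.exists_map_eq_of_exact hfq
      ((d (i + 1)).smulRight G - (d j).smulLeft Y) (by
        rw [Matrix.map_sub _ (map_sub q), Matrix.smulRight_map, Matrix.smulLeft_map, hG, sub_self])
    obtain ⟨T, hT⟩ := Matrix.exists_map_eq_of_exact hfq
      ((d (j + 1)).smulLeft V - (d (i + 2)).smulRight Y) (by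
        rw [Matrix.map_sub _ (map_sub q), Matrix.smulRight_map, Matrix.smulLeft_map, hV, sub_self])
    obtain ⟨H, Z, rfl⟩ := hA.extSyzygy j (by omega) (i + 1) (by omega) W T
      (Matrix.map_linearMap_injective hf (by
        change Matrix.map _ f = Matrix.map _ f
        rw [Matrix.smulRight_map, Matrix.smulLeft_map, ← hW, ← hT, map_sub, map_sub,
          ← Matrix.smulRight_mul, ← Matrix.smulLeft_mul, hd.1, hd.1, Matrix.zero_smulLeft,
          Matrix.zero_smulRight, Matrix.smulLeft_smulRight]))
    obtain ⟨H', Z', h'⟩ := hF.extSyzygy j (by omega) i hi (G - H.map f) (Y + Z.map f) (by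
      rw [map_sub, map_add, sub_eq_iff_eq_add]
      rw [Matrix.map_add _ (map_add f), Matrix.smulRight_map, Matrix.smulLeft_map,
        sub_eq_iff_eq_add] at hW
      rw [hW]; abel)
    refine ⟨H'.map q, Z'.map q, ?_⟩
    rw [← Matrix.smulRight_map, ← Matrix.smulLeft_map, ← Matrix.map_add _ (map_add q), ← h',
      Matrix.map_sub _ (map_sub q), hfq0, sub_zero]

theorem HasFlatDimensionLE.exactCoefficients (hd : IsMatrixResolution d)
    (hR : ∀ i, n ≤ i → ExtRingVanish d i) (hM : ∀ i, n ≤ i → ExtSyzygyVanish d 0 i)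
    {X : Type v} [AddCommGroup X] [Module R X] {D : ℕ} (hX : HasFlatDimensionLE R X D) :
    ExactCoefficients d n X (D + 1) := by
  obtain ⟨F, δ, ε, hF, hD, hε, h₀, hδ⟩ := hX
  -- Descending induction along the flat resolution: the image of `δ i` is zero for `i ≥ D`, and
  -- each step towards degree 0 costs one in `k`.
  have key (k : ℕ) : ∀ i, D ≤ i + k → ExactCoefficients d n (LinearMap.range (δ i)) k := by
    induction k with
    | zero =>
      intro i hi
      have := hD (i + 1) (by omega)
      have : Subsingleton (LinearMap.range (δ i)) :=
        (LinearMap.surjective_rangeRestrict (δ i)).subsingleton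
      exact .of_subsingleton _ _
    | succ k ih =>
      intro i hi
      have := hF (i + 1)
      refine .of_exact hd (f := (LinearMap.range (δ (i + 1))).subtype) (q := (δ i).rangeRestrict)
        Subtype.val_injective (fun x => ?_) (LinearMap.surjective_rangeRestrict _)
        (ih (i + 1) (by omega)) (.of_flat hd hR hM _ _)
      rw [← LinearMap.mem_ker, LinearMap.ker_rangeRestrict, LinearMap.mem_ker, hδ i x]
      simp
  have := hF 0
  refine .of_exact hd (f := (LinearMap.range (δ 0)).subtype) (q := ε) Subtype.val_injective
    (fun x => ?_) hε (key D 0 (by omega)) (.of_flat hd hR hM _ _)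
  rw [h₀ x]
  simp

end ExactCoefficients

/-! ### Descent of splittings along local homomorphisms. -/

/-- If `A * w = A * h * A` with `w` invertible, then the image of `A` is a direct summand. -/
theorem Matrix.exists_mul_mul_eq_of_mul_eq {R : Type u} [CommRing R] {m n : Type} [Fintype m]
    [Fintype n] [DecidableEq m] [DecidableEq n] {A : Matrix m n R} {w : Matrix n n R}
    {h : Matrix n m R} (hw : IsUnit w.det) (e : A * w = A * h * A) :
    ∃ g : Matrix n m R, A * g * A = A := by
  have hp (p : Polynomial R) : A * p.aeval w = p.aeval (A * h) * A := by
    induction p using Polynomial.induction_on' with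
    | add p q hp hq => simp [Matrix.mul_add, Matrix.add_mul, hp, hq]
    | monomial k a =>
      simp only [Polynomial.aeval_monomial, ← Algebra.smul_def, Matrix.mul_smul, Matrix.smul_mul]
      congr 1
      induction k with
      | zero => simp
      | succ k ih => rw [pow_succ, ← Matrix.mul_assoc, ih, Matrix.mul_assoc, e, pow_succ,
          ← Matrix.mul_assoc, ← Matrix.mul_assoc]
  -- By Cayley–Hamilton the inverse of `w` is a polynomial in `w`, so it can be moved across `A` by
  -- `hp`.
  obtain ⟨q, hq⟩ : ∃ q : Polynomial R, w * q.aeval w = 1 := by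
    have hc : IsUnit (w.charpoly.coeff 0) := by
      rw [Matrix.det_eq_sign_charpoly_coeff] at hw
      exact isUnit_of_mul_isUnit_right hw
    obtain ⟨c, hc⟩ := hc
    have h1 := Matrix.aeval_self_charpoly w
    rw [← Polynomial.X_mul_divX_add w.charpoly] at h1
    simp only [map_add, map_mul, Polynomial.aeval_X, Polynomial.aeval_C, ← hc] at h1
    refine ⟨Polynomial.C (-(↑c⁻¹ : R)) * w.charpoly.divX, ?_⟩
    rw [map_mul, Polynomial.aeval_C, ← Algebra.smul_def, Matrix.mul_smul,
      eq_neg_of_add_eq_zero_left h1, Algebra.algebraMap_eq_smul_one, smul_neg, neg_smul, neg_neg,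
      smul_smul, Units.inv_mul, one_smul]
  refine ⟨h * q.aeval (A * h), ?_⟩
  rw [← Matrix.mul_assoc, Matrix.mul_assoc, ← hp, ← Matrix.mul_assoc, ← e, Matrix.mul_assoc, hq,
    Matrix.mul_one]

open IsLocalRing in
/-- A contraction after base change along a local homomorphism gives a splitting. -/
theorem Matrix.exists_mul_mul_eq_of_isLocalHom {R : Type u} [CommRing R] [IsLocalRing R]
    {S : Type v} [CommRing S] [IsLocalRing S] (φ : R →+* S) [IsLocalHom φ] {l m n : Type}
    [Fintype l] [Fintype m] [Fintype n] [DecidableEq l] [DecidableEq m]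
    {A : Matrix l m R} {B : Matrix m n R} (hAB : A * B = 0)
    {H : Matrix m l S} {K : Matrix n m S} (hHK : H * A.map φ + B.map φ * K = 1) :
    ∃ g : Matrix m l R, A * g * A = A := by
  algebraize [ResidueField.map φ]
  -- A linear retraction of the residue field extension carries the contraction back to the residue
  -- field of R. Arbitrary lifts `ρ` of its entries give a matrix congruent to 1 modulo the maximal
  -- ideal, hence invertible.
  obtain ⟨g, hg⟩ := LinearMap.exists_leftInverse_of_injective
    (Algebra.linearMap (ResidueField R) (ResidueField S))
    (LinearMap.ker_eq_bot.2 (algebraMap (ResidueField R) (ResidueField S)).injective)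
  have hg1 : g 1 = 1 := by simpa using LinearMap.congr_fun hg 1
  have hmul (a : R) (x : S) : g (residue S (φ a * x)) = residue R a * g (residue S x) := by
    rw [map_mul, ← ResidueField.map_residue]
    exact (congrArg g (Algebra.smul_def (residue R a) (residue S x)).symm).trans (map_smul g _ _)
  choose ρ hρ using fun x : S => residue_surjective (g (residue S x))
  have hdet : IsUnit (H.map ρ * A + B * K.map ρ).det := by
    have : (H.map ρ * A + B * K.map ρ).map (residue R) = 1 := by
      ext i j
      have h := congrArg (fun x => g (residue S x)) (congrFun (congrFun hHK i) j)
      simp only [Matrix.add_apply, Matrix.mul_apply, Matrix.map_apply, map_add, map_sum] at h ⊢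
      simp only [map_mul, hρ]
      simp only [mul_comm (H i _), hmul] at h
      simp only [mul_comm (g _)]
      rw [h, Matrix.one_apply, Matrix.one_apply]
      split_ifs <;> simp [hg1]
    have h2 := RingHom.map_det (residue R) (H.map ρ * A + B * K.map ρ)
    rw [RingHom.mapMatrix_apply, this, Matrix.det_one] at h2
    exact (isUnit_map_iff (residue R) _).1 (by rw [h2]; exact isUnit_one)
  refine Matrix.exists_mul_mul_eq_of_mul_eq hdet (h := H.map ρ) ?_
  rw [Matrix.mul_add, ← Matrix.mul_assoc A B, hAB, Matrix.zero_mul, add_zero, Matrix.mul_assoc]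

theorem MatrixAR.of_isLocalHom {R : Type u} [CommRing R] [IsLocalRing R]
    {S : Type v} [CommRing S] [IsLocalRing S] (φ : R →+* S) [IsLocalHom φ]
    (hφ : letI := φ.toAlgebra; HasFiniteFlatDimension R S) (hS : MatrixAR S) : MatrixAR R := by
  intro b _ _ d hd n hR hM
  let _ := φ.toAlgebra
  obtain ⟨D, hD⟩ := hφ
  have hX := hD.exactCoefficients hd hR hM
  generalize D + 1 = m at hX
  -- Tor vanishes only from degree `m` on, so the base change is applied to the resolution of the
  -- syzygy `coker (d m)`.
  have hres : IsMatrixResolution fun i => (d (m + i)).map φ := by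
    refine ⟨fun i => ?_, fun i x hx => ?_⟩
    · rw [← Matrix.map_mul]
      exact (congrArg (fun M => Matrix.map M φ) (hd.1 (m + i))).trans
        (Matrix.map_zero _ (map_zero φ))
    · obtain ⟨Y, hY⟩ := hX.tor (m + i) (by omega) Unit (Matrix.of fun a _ => x a) (by
        rw [Matrix.smulLeft_eq_mul]
        exact Matrix.ext fun a _ => congrFun hx a)
      rw [Matrix.smulLeft_eq_mul] at hY
      exact ⟨fun a => Y a (), funext fun a => congrFun (congrFun hY a) ()⟩
  obtain ⟨s, hs⟩ := hS (fun i => b (m + i)) (fun i => (d (m + i)).map φ) hres (n + m)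
    (fun i hi => extRingVanish_of_forall_matrix fun G hG => by
      obtain ⟨Y, hY⟩ := hX.ext (m + i) (by omega) Unit G (by
        rw [Matrix.smulRight_eq_mul]; exact hG)
      rw [Matrix.smulRight_eq_mul] at hY
      exact ⟨Y, hY⟩)
    (fun i hi G Y hG => by
      obtain ⟨H, Z, h⟩ := hX.extSyzygy m le_rfl (m + i) (by omega) G Y (by
        rw [Matrix.smulRight_eq_mul, Matrix.smulLeft_eq_mul]; exact hG)
      rw [Matrix.smulRight_eq_mul, Matrix.smulLeft_eq_mul] at h
      exact ⟨H, Z, h⟩)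
  obtain ⟨H, K, hHK⟩ := hs.contraction hres
  exact ⟨m + s, Matrix.exists_mul_mul_eq_of_isLocalHom φ (hd.1 (m + s)) hHK⟩

/-! ### Matrix conditions as statements about Ext and projective dimension. -/

section FreeResolution

variable {R : Type u} [CommRing R] {b : ℕ → Type} [∀ i, Fintype (b i)] [∀ i, DecidableEq (b i)]
  {d : ∀ i, Matrix (b i) (b (i + 1)) R} (hd : IsMatrixResolution d)
  {M : Type u} [AddCommGroup M] [Module R M] {ε : (b 0 → R) →ₗ[R] M}
  (hε : Function.Surjective ε) (hε' : Function.Exact (d 0).mulVecLin ε)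

/-- The chain complex of free modules with differentials `d`. -/
noncomputable def IsMatrixResolution.complex : ChainComplex (ModuleCat.{u} R) ℕ :=
  ChainComplex.of (fun i => ModuleCat.of R (b i → R)) (fun i => ModuleCat.ofHom (d i).mulVecLin)
    (fun i => by
      rw [← ModuleCat.ofHom_comp, ← Matrix.mulVecLin_mul, hd.1]
      ext; simp)

theorem IsMatrixResolution.complex_d (i : ℕ) :
    hd.complex.d (i + 1) i = ModuleCat.ofHom (d i).mulVecLin :=
  ChainComplex.of_d (fun i => ModuleCat.of R (b i → R))
    (fun i => ModuleCat.ofHom (d i).mulVecLin) i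

/-- The augmentation of the chain complex of free modules with differentials `d`. -/
noncomputable def IsMatrixResolution.augmentation (ε : (b 0 → R) →ₗ[R] M) :
    hd.complex.X 0 ⟶ ModuleCat.of R M :=
  ModuleCat.ofHom ε

include hε' in
theorem IsMatrixResolution.d_comp_augmentation : hd.complex.d 1 0 ≫ hd.augmentation ε = 0 :=
  (congrArg (· ≫ hd.augmentation ε) (hd.complex_d 0)).trans
    (ModuleCat.hom_ext (LinearMap.ext fun x => hε'.apply_apply_eq_zero x))

include hε hε' in
theorem IsMatrixResolution.exact_augmentation :
    (ShortComplex.mk _ _ (hd.d_comp_augmentation hε')).Exact ∧ Epi (hd.augmentation ε) := by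
  constructor
  · rw [ShortComplex.moduleCat_exact_iff]
    intro x hx
    obtain ⟨y, hy⟩ := (hε' x).1 hx
    refine ⟨y, ?_⟩
    change hd.complex.d 1 0 y = x
    rw [hd.complex_d 0]
    exact hy
  · exact (ModuleCat.epi_iff_surjective _).2 hε

/-- The projective resolution with differentials `d`. -/
noncomputable def IsMatrixResolution.projectiveResolution :
    ProjectiveResolution (ModuleCat.of R M) where
  complex := hd.complex
  projective i := (IsProjective.iff_projective (R := R) (b i → R)).1 inferInstance
  π := (ChainComplex.toSingle₀Equiv hd.complex (ModuleCat.of R M)).symm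
    ⟨hd.augmentation ε, hd.d_comp_augmentation hε'⟩
  quasiIso := ⟨fun i => by
    cases i with
    | zero =>
      rw [ChainComplex.quasiIsoAt₀_iff, ShortComplex.quasiIso_iff_of_zeros']
      · refine (ShortComplex.exact_and_epi_g_iff_of_iso ?_).2 (hd.exact_augmentation hε hε')
        refine ShortComplex.isoMk (Iso.refl _) (Iso.refl _) (Iso.refl _)
          ((Category.id_comp _).trans (Category.comp_id _).symm) ?_
        refine (Category.id_comp _).trans (Eq.trans ?_ (Category.comp_id _).symm)
        exact (ChainComplex.toSingle₀Equiv_symm_apply_f_zero _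
          (hd.d_comp_augmentation hε')).symm
      all_goals rfl
    | succ i =>
      rw [quasiIsoAt_iff_exactAt' _ _ (ChainComplex.exactAt_succ_single_obj _ _),
        HomologicalComplex.exactAt_iff' _ (i + 2) (i + 1) i (by simp) (by simp),
        ShortComplex.moduleCat_exact_iff]
      intro x hx
      have hx : hd.complex.d (i + 1) i x = 0 := hx
      rw [hd.complex_d] at hx
      obtain ⟨y, hy⟩ := hd.2 i x hx
      refine ⟨y, ?_⟩
      change hd.complex.d (i + 2) (i + 1) y = x
      rw [hd.complex_d]
      exact hy.symm⟩

include hd hε hε' in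
theorem IsMatrixResolution.subsingleton_ext_iff (X : Type u) [AddCommGroup X] [Module R X] (i : ℕ) :
    Subsingleton (Abelian.Ext (ModuleCat.of R M) (ModuleCat.of R X) (i + 1)) ↔
      ∀ g : (b (i + 1) → R) →ₗ[R] X, g ∘ₗ (d (i + 1)).mulVecLin = 0 →
        ∃ h : (b i → R) →ₗ[R] X, h ∘ₗ (d i).mulVecLin = g := by
  let P := hd.projectiveResolution hε hε'
  have hP (i : ℕ) : P.complex.d (i + 1) i = ModuleCat.ofHom (d i).mulVecLin := hd.complex_d i
  constructor
  · intro h g hg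
    have h1 := (P.extMk_eq_zero_iff (ModuleCat.ofHom g : P.complex.X (i + 1) ⟶ ModuleCat.of R X)
      (i + 2) rfl (by rw [hP]; exact ModuleCat.hom_ext hg) i rfl).1 (Subsingleton.elim _ _)
    obtain ⟨h, hh⟩ := h1
    rw [hP] at hh
    exact ⟨h.hom, congrArg ModuleCat.Hom.hom hh⟩
  · intro h
    refine subsingleton_of_forall_eq 0 fun x => ?_
    obtain ⟨g, hg, rfl⟩ := P.extMk_surjective x (i + 2) rfl
    rw [P.extMk_eq_zero_iff g (i + 2) rfl hg i rfl]
    rw [hP] at hg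
    obtain ⟨k, hk⟩ := h g.hom (congrArg ModuleCat.Hom.hom hg)
    exact ⟨ModuleCat.ofHom k, by rw [hP]; exact ModuleCat.hom_ext hk⟩

end FreeResolution

section FreeResolution

variable {R : Type u} [CommRing R] {b : ℕ → Type} [∀ i, Fintype (b i)] [∀ i, DecidableEq (b i)]
  {d : ∀ i, Matrix (b i) (b (i + 1)) R} (hd : IsMatrixResolution d)
  {M : Type u} [AddCommGroup M] [Module R M] {ε : (b 0 → R) →ₗ[R] M}
  (hε : Function.Surjective ε) (hε' : Function.Exact (d 0).mulVecLin ε)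

theorem Matrix.linearCombination_comp_mulVecLin {m n : Type} [Fintype m] [Fintype n]
    [DecidableEq n] (A : Matrix m n R) (x : m → M) :
    Fintype.linearCombination R x ∘ₗ A.mulVecLin =
      Fintype.linearCombination R fun k => ∑ a, A a k • x a := by
  refine (Pi.basisFun R n).ext fun k => ?_
  simp [Fintype.linearCombination_apply]

theorem LinearMap.exists_eq_linearCombination {m : Type} [Fintype m] [DecidableEq m]
    (g : (m → R) →ₗ[R] M) : ∃ x : m → M, g = Fintype.linearCombination R x :=
  ⟨fun a => g (Pi.single a 1), (Pi.basisFun R m).ext fun k => by simp⟩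

theorem Fintype.linearCombination_inj {m : Type} [Fintype m] [DecidableEq m] {x y : m → M} :
    Fintype.linearCombination R x = Fintype.linearCombination R y ↔ x = y := by
  refine ⟨fun h => funext fun a => ?_, fun h => by rw [h]⟩
  simpa using LinearMap.congr_fun h (Pi.single a 1)

include hd hε hε' in
theorem IsMatrixResolution.subsingleton_ext_iff_forall (X : Type u) [AddCommGroup X] [Module R X]
    (i : ℕ) :
    Subsingleton (Abelian.Ext (ModuleCat.of R M) (ModuleCat.of R X) (i + 1)) ↔
      ∀ x : b (i + 1) → X, (∀ k, ∑ a, d (i + 1) a k • x a = 0) →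
        ∃ y : b i → X, ∀ k, ∑ a, d i a k • y a = x k := by
  have h0 {m : Type} [Fintype m] [DecidableEq m] :
      Fintype.linearCombination R (0 : m → X) = 0 := (Pi.basisFun R m).ext fun k => by simp
  rw [hd.subsingleton_ext_iff hε hε']
  constructor
  · intro h x hx
    obtain ⟨y, hy⟩ := h (Fintype.linearCombination R x) (by
      rw [Matrix.linearCombination_comp_mulVecLin, ← h0, Fintype.linearCombination_inj]
      exact funext hx)
    obtain ⟨y, rfl⟩ := y.exists_eq_linearCombination
    rw [Matrix.linearCombination_comp_mulVecLin, Fintype.linearCombination_inj] at hy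
    exact ⟨y, congrFun hy⟩
  · intro h g hg
    obtain ⟨x, rfl⟩ := g.exists_eq_linearCombination
    rw [Matrix.linearCombination_comp_mulVecLin, ← h0, Fintype.linearCombination_inj] at hg
    obtain ⟨y, hy⟩ := h x (congrFun hg)
    exact ⟨Fintype.linearCombination R y, by
      rw [Matrix.linearCombination_comp_mulVecLin, Fintype.linearCombination_inj]
      exact funext hy⟩

-- A map from a free module to M lifts through `ε` to a matrix, well defined up to the image of `d
-- 0`; this turns cocycles with values in M into matrix equations.
include hd hε hε' in
theorem IsMatrixResolution.subsingleton_ext_prod_iff (i : ℕ) :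
    Subsingleton (Abelian.Ext (ModuleCat.of R M) (ModuleCat.of R (R × M)) (i + 1)) ↔
      ExtRingVanish d i ∧ ExtSyzygyVanish d 0 i := by
  have hcol {m n : Type} [Fintype m] (G : Matrix (b 0) m R) (A : Matrix m n R) (k : n) :
      ε ((G * A).col k) = ∑ a, A a k • ε (G.col a) := by
    simp only [← map_smul, ← map_sum]
    congr 1
    funext j
    simp [Matrix.mul_apply, mul_comm]
  rw [hd.subsingleton_ext_iff_forall hε hε']
  constructor
  · refine fun h => ⟨fun x hx => ?_, fun G Y hG => ?_⟩
    · obtain ⟨y, hy⟩ := h (fun a => (x a, 0)) (fun k => Prod.ext (by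
        simpa [Prod.fst_sum, Matrix.vecMul, dotProduct, mul_comm] using congrFun hx k) (by
        simp [Prod.snd_sum]))
      refine ⟨fun a => (y a).1, funext fun k => ?_⟩
      simpa [Prod.fst_sum, Matrix.vecMul, dotProduct, mul_comm] using
        (congrArg Prod.fst (hy k)).symm
    · obtain ⟨y, hy⟩ := h (fun a => (0, ε (G.col a))) (fun k => Prod.ext (by
        simp [Prod.fst_sum]) (by
        simp only [Prod.snd_sum, Prod.smul_snd]
        rw [← hcol, hG]
        exact hε'.apply_apply_eq_zero (Y.col k)))
      choose H hH using fun a => hε (y a).2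
      have hz (k : b (i + 1)) : ∃ z, (d 0).mulVecLin z = (G - (Matrix.of H).transpose * d i).col k := by
        refine (hε' _).1 ?_
        have h1 := congrArg Prod.snd (hy k)
        simp only [Prod.snd_sum, Prod.smul_snd, ← hH] at h1
        have h2 := hcol (Matrix.of H).transpose (d i) k
        have h3 : (G - (Matrix.of H).transpose * d i).col k =
          G.col k - ((Matrix.of H).transpose * d i).col k := rfl
        rw [h3, map_sub, h2, ← h1]
        exact sub_self _
      choose Z hZ using hz
      refine ⟨(Matrix.of H).transpose, (Matrix.of Z).transpose, ?_⟩
      exact sub_eq_iff_eq_add'.1 <| Matrix.ext fun a k => (congrFun (hZ k) a).symm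
  · rintro ⟨hR, hM⟩ x hx
    obtain ⟨y, hy⟩ := hR (fun a => (x a).1) (funext fun k => by
      simpa [Prod.fst_sum, Matrix.vecMul, dotProduct, mul_comm] using congrArg Prod.fst (hx k))
    choose G hG using fun a => hε (x a).2
    have hY (k : b (i + 2)) : ∃ z, (d 0).mulVecLin z = ((Matrix.of G).transpose * d (i + 1)).col k := by
      refine (hε' _).1 ?_
      rw [hcol]
      have h1 := congrArg Prod.snd (hx k)
      simp only [Prod.snd_sum, Prod.smul_snd, ← hG] at h1
      exact h1
    choose Y hY using hY
    obtain ⟨H, Z, hH⟩ := hM (Matrix.of G).transpose (Matrix.of Y).transpose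
      (Matrix.ext fun a k => (congrFun (hY k) a).symm)
    refine ⟨fun a => (y a, ε (H.col a)), fun k => Prod.ext ?_ ?_⟩
    · simpa [Prod.fst_sum, Matrix.vecMul, dotProduct, mul_comm] using (congrFun hy k).symm
    · simp only [Prod.snd_sum, Prod.smul_snd]
      rw [← hcol, ← hG]
      have h1 : G k = (H * d i).col k + (d 0).mulVecLin (Z.col k) :=
        funext fun a => congrFun (congrFun hH a) k
      rw [h1, map_add, hε'.apply_apply_eq_zero, add_zero]

include hd hε hε' in
theorem IsMatrixResolution.splitsAt_iff (s : ℕ) :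
    SplitsAt d s ↔ HasProjectiveDimensionLE (ModuleCat.of R M) s := by
  constructor
  · intro hs
    refine HasProjectiveDimensionLT.mk fun i hi X e => ?_
    obtain ⟨i, rfl⟩ : ∃ k, i = k + 1 := ⟨i - 1, by omega⟩
    have : Subsingleton (Abelian.Ext (ModuleCat.of R M) X (i + 1)) := by
      refine (hd.subsingleton_ext_iff hε hε' X i).2 fun g hg => ?_
      obtain ⟨H, K, hHK⟩ := (hs.mono hd (show s ≤ i by omega)).contraction hd
      refine ⟨g ∘ₗ H.mulVecLin, ?_⟩
      have := congrArg Matrix.mulVecLin hHK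
      rw [Matrix.mulVecLin_add, Matrix.mulVecLin_mul, Matrix.mulVecLin_mul, Matrix.mulVecLin_one]
        at this
      have := congrArg (g ∘ₗ ·) this
      simpa only [LinearMap.comp_add, ← LinearMap.comp_assoc, hg, LinearMap.zero_comp, add_zero,
        LinearMap.comp_id] using this
    exact Subsingleton.elim _ _
  · intro h
    -- The class to test is `d s` itself, viewed as a cocycle with values in its image; bounding it
    -- splits the image off.
    have := HasProjectiveDimensionLT.subsingleton (ModuleCat.of R M) (s + 1) (s + 1) le_rfl
      (ModuleCat.of R (LinearMap.range (d s).mulVecLin))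
    rw [hd.subsingleton_ext_iff hε hε'] at this
    obtain ⟨h, hh⟩ := this (d s).mulVecLin.rangeRestrict (LinearMap.ext fun x => Subtype.ext (by
      change (d s).mulVec ((d (s + 1)).mulVec x) = 0
      rw [Matrix.mulVec_mulVec, hd.1, Matrix.zero_mulVec]))
    choose y hy using fun a => (h (Pi.single a 1)).2
    have hy' : (d s).mulVecLin ∘ₗ (Matrix.of y).transpose.mulVecLin =
        (LinearMap.range (d s).mulVecLin).subtype ∘ₗ h := by
      refine (Pi.basisFun R _).ext fun a => ?_
      simp only [Pi.basisFun_apply, LinearMap.comp_apply, Matrix.mulVecLin_apply,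
        Matrix.mulVec_single_one]
      exact hy a
    refine ⟨(Matrix.of y).transpose, ?_⟩
    apply Matrix.mulVec_injective
    have e := congrArg ((LinearMap.range (d s).mulVecLin).subtype ∘ₗ ·) hh
    simp only [← LinearMap.comp_assoc, ← hy', ← Matrix.mulVecLin_mul] at e
    exact congrArg DFunLike.coe e

end FreeResolution

/-! ### Equivalence of the two forms of the property. -/

theorem exists_matrix_exact {R : Type u} [CommRing R] [IsNoetherianRing R] {m : Type} [Fintype m]
    {M : Type v} [AddCommGroup M] [Module R M] (f : (m → R) →ₗ[R] M) :
    ∃ (k : ℕ) (B : Matrix m (Fin k) R), Function.Exact B.mulVecLin f := by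
  classical
  obtain ⟨k, g, hg⟩ := Module.Finite.exists_fin' R (LinearMap.ker f)
  refine ⟨k, LinearMap.toMatrix' ((LinearMap.ker f).subtype ∘ₗ g), ?_⟩
  rw [← Matrix.toLin'_apply', Matrix.toLin'_toMatrix', LinearMap.exact_iff, LinearMap.range_comp,
    LinearMap.range_eq_top.2 hg, Submodule.map_top, Submodule.range_subtype]

theorem exists_isMatrixResolution (R : Type u) [CommRing R] [IsNoetherianRing R] (M : Type v)
    [AddCommGroup M] [Module R M] [Module.Finite R M] :
    ∃ (b : ℕ → ℕ) (d : ∀ i, Matrix (Fin (b i)) (Fin (b (i + 1))) R) (ε : (Fin (b 0) → R) →ₗ[R] M),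
      IsMatrixResolution d ∧ Function.Surjective ε ∧ Function.Exact (d 0).mulVecLin ε := by
  obtain ⟨n, ε, hε⟩ := Module.Finite.exists_fin' R M
  obtain ⟨k, B, hB⟩ := exists_matrix_exact ε
  have next (S : Σ n m : ℕ, Matrix (Fin n) (Fin m) R) :
      ∃ (k : ℕ) (C : Matrix (Fin S.2.1) (Fin k) R), Function.Exact C.mulVecLin S.2.2.mulVecLin :=
    exists_matrix_exact _
  choose K C hC using next
  let S : ℕ → Σ n m : ℕ, Matrix (Fin n) (Fin m) R :=
    fun i => Nat.rec ⟨n, k, B⟩ (fun _ T => ⟨T.2.1, K T, C T⟩) i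
  have hS (i : ℕ) : Function.Exact (S (i + 1)).2.2.mulVecLin (S i).2.2.mulVecLin := hC (S i)
  refine ⟨fun i => (S i).1, fun i => (S i).2.2, ε, ⟨fun i => ?_, fun i x hx => ?_⟩, hε, hB⟩
  · apply Matrix.mulVec_injective
    funext x
    rw [Matrix.zero_mulVec, ← Matrix.mulVec_mulVec]
    exact (hS i).apply_apply_eq_zero x
  · obtain ⟨y, hy⟩ := (hS i x).1 hx
    exact ⟨y, hy.symm⟩

theorem HasAuslanderReitenProperty.matrixAR {R : Type u} [CommRing R]
    (h : HasAuslanderReitenProperty R) : MatrixAR R := by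
  intro b _ _ d hd n hR hM
  have h := h ((b 0 → R) ⧸ LinearMap.range (d 0).mulVecLin)
  have hε := Submodule.mkQ_surjective (LinearMap.range (d 0).mulVecLin)
  have hε' : Function.Exact (d 0).mulVecLin (LinearMap.range (d 0).mulVecLin).mkQ := by
    rw [LinearMap.exact_iff, Submodule.ker_mkQ]
  refine ⟨n, (hd.splitsAt_iff hε hε' n).2 ?_⟩
  rw [← projectiveDimension_le_iff, h]
  refine iSup₂_le fun i hi => ?_
  by_contra hn
  have hn : n < i := by
    by_contra hle
    exact hn (by exact_mod_cast (not_lt.1 hle))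
  obtain ⟨i, rfl⟩ : ∃ k, i = k + 1 := ⟨i - 1, by omega⟩
  rw [← not_subsingleton_iff_nontrivial, hd.subsingleton_ext_prod_iff hε hε'] at hi
  exact hi ⟨hR i (by omega), hM i (by omega)⟩

theorem MatrixAR.hasAuslanderReitenProperty {R : Type u} [CommRing R] [IsNoetherianRing R]
    (h : MatrixAR R) : HasAuslanderReitenProperty R := by
  intro M _ _ _
  obtain ⟨b, d, ε, hd, hε, hε'⟩ := exists_isMatrixResolution R M
  apply le_antisymm
  · by_contra hlt
    rw [not_le] at hlt
    have hbound (i : ℕ) (hi : projectiveDimension (ModuleCat.of R M) ≤ i) :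
        Subsingleton (Abelian.Ext (ModuleCat.of R M) (ModuleCat.of R (R × M)) i) := by
      by_contra hn
      rw [not_subsingleton_iff_nontrivial] at hn
      exact (hlt.trans_le hi).not_ge (le_iSup₂_of_le i hn le_rfl)
    -- A supremum below the projective dimension is bounded by some natural number `n`, so
    -- `MatrixAR` applies and forces finite projective dimension.
    have htop : projectiveDimension (ModuleCat.of R M) ≠ ⊤ := by
      obtain ⟨n, hn⟩ : ∃ n : ℕ, (⨆ (i : ℕ)
          (_ : Nontrivial (Abelian.Ext (ModuleCat.of R M) (ModuleCat.of R (R × M)) i)),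
          (i : WithBot ℕ∞)) ≤ n := by
        revert hlt
        generalize (⨆ (i : ℕ) (_ : Nontrivial (Abelian.Ext (ModuleCat.of R M)
          (ModuleCat.of R (R × M)) i)), (i : WithBot ℕ∞)) = S
        intro hlt
        induction S with
        | bot => exact ⟨0, bot_le⟩
        | coe S =>
          induction S with
          | top => exact absurd hlt not_top_lt
          | coe n => exact ⟨n, le_rfl⟩
      have hvan (i : ℕ) (hi : n ≤ i) : ExtRingVanish d i ∧ ExtSyzygyVanish d 0 i := by
        rw [← hd.subsingleton_ext_prod_iff hε hε', ← not_nontrivial_iff_subsingleton]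
        intro hnt
        have : ((i + 1 : ℕ) : WithBot ℕ∞) ≤ n := (le_iSup₂_of_le (i + 1) hnt le_rfl).trans hn
        have : i + 1 ≤ n := by exact_mod_cast this
        omega
      obtain ⟨s, hs⟩ := h _ d hd n (fun i hi => (hvan i hi).1) fun i hi => (hvan i hi).2
      exact (projectiveDimension_ne_top_iff _).2 ⟨s, (hd.splitsAt_iff hε hε' s).1 hs⟩
    obtain ⟨p, hp⟩ : ∃ p : ℕ, projectiveDimension (ModuleCat.of R M) = p := by
      generalize projectiveDimension (ModuleCat.of R M) = P at hlt htop
      induction P with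
      | bot => exact absurd hlt not_lt_bot
      | coe P =>
        induction P with
        | top => exact absurd rfl htop
        | coe n => exact ⟨n, rfl⟩
    have hsub := hbound p hp.le
    cases p with
    | zero =>
      -- Ext^0(M, R ⊕ M) contains the inclusion of M, so its vanishing forces M = 0, of dimension
      -- `⊥` rather than 0.
      have hM : Subsingleton M := by
        refine subsingleton_of_forall_eq 0 fun x => ?_
        have h1 := Abelian.Ext.homEquiv₀.symm.injective (Subsingleton.elim
          (Abelian.Ext.homEquiv₀.symm (ModuleCat.ofHom (LinearMap.inr R R M)))
          (Abelian.Ext.homEquiv₀.symm 0))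
        exact congrArg Prod.snd (LinearMap.congr_fun (congrArg ModuleCat.Hom.hom h1) x)
      rw [(projectiveDimension_eq_bot_iff _).2 (ModuleCat.isZero_of_subsingleton _)] at hp
      exact absurd hp (by simp)
    | succ q =>
      have hq := ((hd.subsingleton_ext_prod_iff hε hε' q).1 hsub).1
      -- With `d (q + 1)` split by `k`, the rows of `1 - d (q + 1) * k` are cocycles for
      -- Ext^(q+1)(M, R). Writing this matrix as `H * d q` splits `d q`, contradicting projective
      -- dimension `q + 1`.
      obtain ⟨k, hk⟩ := (hd.splitsAt_iff hε hε' (q + 1)).2 ((projectiveDimension_le_iff _ _).1 hp.le)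
      obtain ⟨H, hH⟩ := hq.exact (1 - d (q + 1) * k) (by
        rw [Matrix.sub_mul, Matrix.one_mul, hk, sub_self])
      have hs : SplitsAt d q := ⟨H, by
        rw [Matrix.mul_assoc, ← hH, Matrix.mul_sub, Matrix.mul_one, ← Matrix.mul_assoc, hd.1,
          Matrix.zero_mul, sub_zero]⟩
      have := (projectiveDimension_le_iff _ _).2 ((hd.splitsAt_iff hε hε' q).1 hs)
      rw [hp] at this
      have : q + 1 ≤ q := by exact_mod_cast this
      omega
  · refine iSup₂_le fun i hi => ?_
    rw [projectiveDimension_ge_iff]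
    intro hpd
    exact not_subsingleton_iff_nontrivial.2 hi
      (HasProjectiveDimensionLT.subsingleton (ModuleCat.of R M) i i le_rfl _)

theorem mainTheorem9 (R : Type u) (R' : Type v) (Q : Type w)
    [CommRing R] [IsLocalRing R] [IsNoetherianRing R]
    [CommRing R'] [IsLocalRing R'] [IsNoetherianRing R']
    [CommRing Q] [IsLocalRing Q] [IsNoetherianRing Q]
    (φ : R →+* R') [IsLocalHom φ]
    (hφ : letI := φ.toAlgebra; HasFiniteFlatDimension R R')
    (π : Q →+* R') (hπ : IsDeformation π)
    (hQ : HasAuslanderReitenProperty Q) :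
    HasAuslanderReitenProperty R := by
  obtain ⟨hsurj, fs, hreg, hker⟩ := hπ
  exact ((hQ.matrixAR.of_isWeaklyRegular hsurj hreg.toIsWeaklyRegular
    hker).of_isLocalHom φ hφ).hasAuslanderReitenProperty
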